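/- A biframe $\mathcal L=(L^+,L^-,L)$ consists of three frames with injective frame maps $e^+:L^+\to L$, $e^-:L^-\to L$ such that every element of $L$ has the form $\bigvee_i e^+(x_i)\wedge e^-(y_i)$ with $x_i\in L^+$, $y_i\in L^-$. A biframe map $\mathcal L\to\mathcal M$ is a pair of frame maps $f^\pm:L^\pm\to M^\pm$ for which there is a frame map $f:L\to M$ with $f e_L^\pm=e_M^\pm f^\pm$. If $R$ is a relation on $L$ and $C$ is the least frame congruence on $L$ with $[a]\le[b]$ in $L/C$ for all $(a,b)\in R$, then $\mathcal L/R=(L^+/C^+,L^- /C^-,L/C)$, where $C^\pm$ is the restriction of $C$ along $e^\pm$. For a frame $L$ let $\mathsf A(L)$ be the frame of all frame congruences on $L$ ordered by inclusion, and for $x\in L$ put $\nabla(x)=\{(a,b): a\vee x=b\vee x\}$, $\Delta(x)=\{(a,b): a\wedge x=b\wedge x\}$. For a biframe $\mathcal L$ an element of $L$ is finitary if it is a finite join of elements $e^+(x)\wedge e^-(y)$, and $\mathsf A_{\mathrm{fin}}(L)$ is the subframe of $\mathsf A(L)$ generated by all $\nabla(x)$, $x\in L$, and all $\Delta(s)$,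 $s$ finitary. For $x^\pm\in L^\pm$ write $\nabla(x^\pm)=\nabla(e^\pm(x^\pm))$ and $\Delta(x^\pm)=\Delta(e^\pm(x^\pm))$. The assembly of $\mathcal L$ is the biframe $$\mathsf A(\mathcal L)=(\mathsf A_{\nabla^+\Delta^-}(L),\mathsf A_{\nabla^-\Delta^+}(L),\mathsf A_{\mathrm{fin}}(L)),$$ where $\mathsf A_{\nabla^+\Delta^-}(L)$ (respectively $\mathsf A_{\nabla^-\Delta^+}(L)$) is the subframe of $\mathsf A_{\mathrm{fin}}(L)$ generated by all $\nabla(x^+)$ and $\Delta(x^-)$ (respectively all $\nabla(x^-)$ and $\Delta(x^+)$), with the inclusions as injections. For a bounded distributive lattice $D$ let $\mathsf F(D)$ be the frame of filters of $D$ ordered by inclusion, and ${\uparrow}x$ the principal filter of $x$. Let $\oplus$ be the coproduct of frames, and identify elements with their images under the coproduct injections. Let $\mathsf A^m(\mathcal L)$ be the biframe $$(L^+\oplus\mathsf F(L^-),\;L^-\oplus\mathsf F(L^+),\;L^+\oplus\mathsf F(L^-)\oplus L^-\oplus\mathsf F(L^+)).$$ On its main component let $C_L$ be the image, under the canonical map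 from $L^+\oplus L^-$, of the kernel congruence of the frame map $L^+\oplus L^-\to L$ induced by $e^+$ and $e^-$, and let $$\mathrm{Com}^\pm_L=\{(x^\pm\wedge{\uparrow}x^\pm,\,0),\ (1,\,x^\pm\vee{\uparrow}x^\pm): x^\pm\in L^\pm\}.$$ Proposition. For every biframe $\mathcal L$ there is exactly one isomorphism of biframes $$\mathsf A(\mathcal L)\;\cong\;\mathsf A^m(\mathcal L)/(C_L\cup\mathrm{Com}^+_L\cup\mathrm{Com}^-_L)$$ which sends $\nabla(x^+)\mapsto[x^+]$ and $\Delta(x^-)\mapsto[{\uparrow}x^-]$ on the positive component, and $\nabla(x^-)\mapsto[x^-]$ and $\Delta(x^+)\mapsto[{\uparrow}x^+]$ on the negative component, for all $x^+\in L^+$, $x^-\in L^-$. -/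

import Mathlib

universe u v w

open CategoryTheory

/-- A complete lattice with a binary operation right adjoint to meets is a frame. -/
abbrev frameOfImp {α : Type u} [CompleteLattice α] (imp : α → α → α)
    (h : ∀ a b c, a ≤ imp b c ↔ a ⊓ b ≤ c) : Order.Frame α :=
  .ofMinimalAxioms
    { inf_sSup_le_iSup_inf := fun a s => by
        rw [inf_comm, ← h]
        refine sSup_le fun b hb => ?_
        rw [h, inf_comm]
        exact le_iSup₂_of_le b hb le_rfl }

/-! ### Subframes -/

/-- A subframe of `L`: a subset closed under finite meets and arbitrary joins. -/
structure Subframe (L : Type u) [Order.Frame L] where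
  carrier : Set L
  top_mem : ⊤ ∈ carrier
  inf_mem : ∀ {a b}, a ∈ carrier → b ∈ carrier → a ⊓ b ∈ carrier
  sSup_mem : ∀ S : Set L, S ⊆ carrier → sSup S ∈ carrier

namespace Subframe

variable {L : Type u} [Order.Frame L]

/-- The elements of a subframe. -/
def Elt (K : Subframe L) : Type u := {x : L // x ∈ K.carrier}

instance (K : Subframe L) : PartialOrder K.Elt :=
  inferInstanceAs (PartialOrder {x : L // x ∈ K.carrier})

theorem sSup_val_mem (K : Subframe L) (S : Set K.Elt) : sSup (Subtype.val '' S) ∈ K.carrier :=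
  K.sSup_mem _ (by rintro _ ⟨x, _, rfl⟩; exact x.2)

instance (K : Subframe L) : SupSet K.Elt :=
  ⟨fun S => ⟨sSup (Subtype.val '' S), K.sSup_val_mem S⟩⟩

theorem isLUB_sSup (K : Subframe L) (S : Set K.Elt) : IsLUB S (sSup S) := by
  constructor
  · intro x hx
    show x.1 ≤ sSup (Subtype.val '' S)
    exact le_sSup ⟨x, hx, rfl⟩
  · intro y hy
    show sSup (Subtype.val '' S) ≤ y.1
    refine sSup_le ?_
    rintro _ ⟨x, hx, rfl⟩
    exact hy hx

instance (K : Subframe L) : CompleteLattice K.Elt where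
  __ := completeLatticeOfSup K.Elt K.isLUB_sSup
  top := ⟨⊤, K.top_mem⟩
  le_top := fun x => (le_top : x.1 ≤ ⊤)
  inf := fun x y => ⟨x.1 ⊓ y.1, K.inf_mem x.2 y.2⟩
  inf_le_left := fun x y => (inf_le_left : x.1 ⊓ y.1 ≤ x.1)
  inf_le_right := fun x y => (inf_le_right : x.1 ⊓ y.1 ≤ y.1)
  le_inf := fun x y z hy hz => (le_inf hy hz : x.1 ≤ y.1 ⊓ z.1)

instance (K : Subframe L) : Order.Frame K.Elt :=
  .ofMinimalAxioms
    { inf_sSup_le_iSup_inf := fun a s => by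
        show a.1 ⊓ sSup (Subtype.val '' s) ≤ (⨆ b ∈ s, a ⊓ b : K.Elt).1
        rw [inf_sSup_eq]
        refine iSup₂_le ?_
        rintro _ ⟨b, hb, rfl⟩
        exact (le_iSup₂_of_le b hb le_rfl : a ⊓ b ≤ ⨆ b ∈ s, a ⊓ b) }

/-- The inclusion of a subframe. -/
def incl (K : Subframe L) : FrameHom K.Elt L where
  toFun := Subtype.val
  map_inf' _ _ := rfl
  map_top' := rfl
  map_sSup' _ := rfl

theorem incl_injective (K : Subframe L) : Function.Injective K.incl :=
  fun _ _ h => Subtype.ext h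

/-- The subframe generated by a subset. -/
def closure (S : Set L) : Subframe L where
  carrier := {x | ∀ K : Subframe L, S ⊆ K.carrier → x ∈ K.carrier}
  top_mem := fun K _ => K.top_mem
  inf_mem := fun ha hb K hK => K.inf_mem (ha K hK) (hb K hK)
  sSup_mem := fun _ hT K hK => K.sSup_mem _ fun _ hx => hT hx K hK

theorem subset_closure (S : Set L) : S ⊆ (closure S).carrier :=
  fun _ hx _ hK => hK hx

end Subframe

/-- The elements of the form `⨆ i, f aᵢ ⊓ g bᵢ` form a subframe. -/
def meetJoinSubframe {A : Type u} {B : Type v} {L : Type w} [Order.Frame A] [Order.Frame B]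
    [Order.Frame L] (f : FrameHom A L) (g : FrameHom B L) : Subframe L where
  carrier := {x | ∃ S : Set (A × B), x = ⨆ p ∈ S, f p.1 ⊓ g p.2}
  top_mem := ⟨{(⊤, ⊤)}, by simp⟩
  inf_mem := by
    rintro _ _ ⟨S, rfl⟩ ⟨T, rfl⟩
    refine ⟨{r | ∃ p ∈ S, ∃ q ∈ T, r = (p.1 ⊓ q.1, p.2 ⊓ q.2)}, le_antisymm ?_ ?_⟩
    · rw [iSup₂_inf_eq]
      refine iSup₂_le fun p hp => ?_
      rw [inf_iSup₂_eq]
      refine iSup₂_le fun q hq => ?_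
      refine le_iSup₂_of_le (p.1 ⊓ q.1, p.2 ⊓ q.2) ⟨p, hp, q, hq, rfl⟩ ?_
      simp only [map_inf]
      exact (inf_inf_inf_comm _ _ _ _).le
    · refine iSup₂_le ?_
      rintro _ ⟨p, hp, q, hq, rfl⟩
      simp only [map_inf]
      rw [inf_inf_inf_comm]
      exact inf_le_inf (le_iSup₂_of_le p hp le_rfl) (le_iSup₂_of_le q hq le_rfl)
  sSup_mem := by
    intro X hX
    refine ⟨{p | f p.1 ⊓ g p.2 ≤ sSup X}, le_antisymm ?_ (iSup₂_le fun p hp => hp)⟩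
    refine sSup_le fun x hx => ?_
    obtain ⟨S, hS⟩ := hX hx
    rw [hS]
    refine iSup₂_le fun p hp => le_iSup₂_of_le p ?_ le_rfl
    have h1 : f p.1 ⊓ g p.2 ≤ x := by
      rw [hS]; exact le_iSup₂_of_le p hp le_rfl
    exact h1.trans (le_sSup hx)

theorem left_mem_meetJoinSubframe {A : Type u} {B : Type v} {L : Type w} [Order.Frame A]
    [Order.Frame B] [Order.Frame L] (f : FrameHom A L) (g : FrameHom B L) (a : A) :
    f a ∈ (meetJoinSubframe f g).carrier :=
  ⟨{(a, ⊤)}, by simp⟩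

theorem right_mem_meetJoinSubframe {A : Type u} {B : Type v} {L : Type w} [Order.Frame A]
    [Order.Frame B] [Order.Frame L] (f : FrameHom A L) (g : FrameHom B L) (b : B) :
    g b ∈ (meetJoinSubframe f g).carrier :=
  ⟨{(⊤, b)}, by simp⟩

/-! ### Frame congruences, quotients and the assembly of a frame -/

/-- A congruence on a frame: an equivalence relation compatible with finite meets and
arbitrary joins. -/
structure FrameCongr (L : Type u) [Order.Frame L] where
  rel : L → L → Prop
  refl : ∀ a, rel a a
  symm : ∀ {a b}, rel a b → rel b a
  trans : ∀ {a b c}, rel a b → rel b c → rel a c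
  inf_rel : ∀ {a b c d}, rel a b → rel c d → rel (a ⊓ c) (b ⊓ d)
  sSup_rel : ∀ S : Set (L × L), (∀ p ∈ S, rel p.1 p.2) →
    rel (sSup (Prod.fst '' S)) (sSup (Prod.snd '' S))

namespace FrameCongr

variable {L : Type u} [Order.Frame L]

theorem rel_injective : Function.Injective (rel : FrameCongr L → L → L → Prop) := by
  rintro ⟨r, _, _, _, _, _⟩ ⟨s, _, _, _, _, _⟩ h
  cases h
  rfl

/-- Congruences are ordered by inclusion. -/
instance : PartialOrder (FrameCongr L) where
  le θ φ := ∀ a b, θ.rel a b → φ.rel a b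
  le_refl _ _ _ h := h
  le_trans _ _ _ h h' a b hab := h' a b (h a b hab)
  le_antisymm _ _ h h' :=
    rel_injective (funext fun a => funext fun b => propext ⟨h a b, h' a b⟩)

instance : InfSet (FrameCongr L) where
  sInf T :=
    { rel := fun a b => ∀ θ ∈ T, θ.rel a b
      refl := fun a θ _ => θ.refl a
      symm := fun h θ hθ => θ.symm (h θ hθ)
      trans := fun h h' θ hθ => θ.trans (h θ hθ) (h' θ hθ)
      inf_rel := fun h h' θ hθ => θ.inf_rel (h θ hθ) (h' θ hθ)
      sSup_rel := fun S hS θ hθ => θ.sSup_rel S fun p hp => hS p hp θ hθ }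

instance : Min (FrameCongr L) where
  min θ φ :=
    { rel := fun a b => θ.rel a b ∧ φ.rel a b
      refl := fun a => ⟨θ.refl a, φ.refl a⟩
      symm := fun h => ⟨θ.symm h.1, φ.symm h.2⟩
      trans := fun h h' => ⟨θ.trans h.1 h'.1, φ.trans h.2 h'.2⟩
      inf_rel := fun h h' => ⟨θ.inf_rel h.1 h'.1, φ.inf_rel h.2 h'.2⟩
      sSup_rel := fun S hS => ⟨θ.sSup_rel S fun p hp => (hS p hp).1, φ.sSup_rel S fun p hp => (hS p hp).2⟩ }

theorem isGLB_sInf (T : Set (FrameCongr L)) : IsGLB T (sInf T) :=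
  ⟨fun θ hθ _ _ h => h θ hθ, fun _ hφ a b h _ hθ => hφ hθ a b h⟩

instance : CompleteLattice (FrameCongr L) where
  __ := completeLatticeOfInf (FrameCongr L) isGLB_sInf
  inf := (· ⊓ ·)
  inf_le_left _ _ _ _ h := h.1
  inf_le_right _ _ _ _ h := h.2
  le_inf _ _ _ h h' a b hab := ⟨h a b hab, h' a b hab⟩

theorem sup_rel (θ : FrameCongr L) {a b c d : L} (h : θ.rel a b) (h' : θ.rel c d) :
    θ.rel (a ⊔ c) (b ⊔ d) := by
  have := θ.sSup_rel {(a, b), (c, d)} (by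
    rintro p (rfl | rfl)
    · exact h
    · exact h')
  simpa [Set.image_pair, sSup_pair] using this

/-- The image of a set under `x ↦ (x ⊓ d) ⊔ c` has join `(sSup ⊓ d) ⊔ c`, up to adding `c`. -/
theorem sSup_image_inf_sup (T : Set L) (c d : L) :
    (sSup T ⊓ d) ⊔ c = sSup ((fun x => (x ⊓ d) ⊔ c) '' T) ⊔ c := by
  rw [sSup_inf_eq, sSup_image]
  apply le_antisymm
  · refine sup_le (iSup₂_le fun x hx => ?_) le_sup_right
    exact (le_sup_left.trans (le_iSup₂_of_le (f := fun x (_ : x ∈ T) => (x ⊓ d) ⊔ c)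
      x hx le_rfl)).trans le_sup_left
  · refine sup_le (iSup₂_le fun x hx => sup_le_sup_right ?_ c) le_sup_right
    exact le_iSup₂_of_le (f := fun x (_ : x ∈ T) => x ⊓ d) x hx le_rfl

/-- The Heyting implication of congruences. -/
def imp (θ φ : FrameCongr L) : FrameCongr L where
  rel a b := ∀ c d, c ≤ d → θ.rel c d → φ.rel ((a ⊓ d) ⊔ c) ((b ⊓ d) ⊔ c)
  refl _ _ _ _ _ := φ.refl _
  symm h c d hcd hθ := φ.symm (h c d hcd hθ)
  trans h h' c d hcd hθ := φ.trans (h c d hcd hθ) (h' c d hcd hθ)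
  inf_rel {a b a' b'} h h' c d hcd hθ := by
    have := φ.inf_rel (h c d hcd hθ) (h' c d hcd hθ)
    rwa [← sup_inf_right, ← sup_inf_right, ← inf_inf_distrib_right,
      ← inf_inf_distrib_right] at this
  sSup_rel S hS c d hcd hθ := by
    rw [sSup_image_inf_sup, sSup_image_inf_sup]
    refine φ.sup_rel ?_ (φ.refl c)
    have := φ.sSup_rel ((fun p : L × L => ((p.1 ⊓ d) ⊔ c, (p.2 ⊓ d) ⊔ c)) '' S) (by
      rintro _ ⟨p, hp, rfl⟩
      exact hS p hp c d hcd hθ)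
    simpa only [Set.image_image] using this

theorem le_imp_iff (ψ θ φ : FrameCongr L) : ψ ≤ imp θ φ ↔ ψ ⊓ θ ≤ φ := by
  constructor
  · rintro h a b ⟨hψ, hθ⟩
    have h1 : θ.rel (a ⊓ b) (a ⊔ b) :=
      θ.trans (b := a) (by simpa using θ.inf_rel (θ.refl a) (θ.symm hθ))
        (by simpa using θ.sup_rel (θ.refl a) hθ)
    have h2 := h a b hψ (a ⊓ b) (a ⊔ b) (inf_le_left.trans le_sup_left) h1
    simpa using h2
  · intro h a b hψ c d hcd hθ
    refine h _ _ ⟨ψ.sup_rel (ψ.inf_rel hψ (ψ.refl d)) (ψ.refl c), ?_⟩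
    have key : ∀ x : L, θ.rel ((x ⊓ d) ⊔ c) c := fun x => by
      have := θ.sup_rel (θ.inf_rel (θ.refl x) (θ.symm hθ)) (θ.refl c)
      simpa using this
    exact θ.trans (key a) (θ.symm (key b))

/-- The assembly of the frame `L`: its congruences, ordered by inclusion, form a frame. -/
instance : Order.Frame (FrameCongr L) := frameOfImp imp le_imp_iff

/-- The closed congruence `∇(x)`. -/
def nabla (x : L) : FrameCongr L where
  rel a b := a ⊔ x = b ⊔ x
  refl _ := rfl
  symm h := Eq.symm h
  trans h h' := Eq.trans h h'
  inf_rel {a b c d} h h' := by rw [sup_inf_right, sup_inf_right, h, h']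
  sSup_rel S hS := by
    have key : ∀ T : Set L, sSup T ⊔ x = sSup ((fun a => a ⊔ x) '' T) ⊔ x := fun T => by
      have := sSup_image_inf_sup T x ⊤
      simpa using this
    rw [key, key (Prod.snd '' S), Set.image_image, Set.image_image,
      Set.image_congr (g := fun p : L × L => p.2 ⊔ x) hS]

/-- The open congruence `Δ(x)`. -/
def delta (x : L) : FrameCongr L where
  rel a b := a ⊓ x = b ⊓ x
  refl _ := rfl
  symm h := Eq.symm h
  trans h h' := Eq.trans h h'
  inf_rel {a b c d} h h' := by rw [inf_inf_distrib_right, inf_inf_distrib_right b, h, h']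
  sSup_rel S hS := by
    rw [sSup_inf_eq, sSup_inf_eq, iSup_image, iSup_image]
    exact iSup_congr fun p => iSup_congr fun hp => hS p hp

theorem nabla_le_iff (x : L) (θ : FrameCongr L) : nabla x ≤ θ ↔ θ.rel ⊥ x := by
  constructor
  · intro h
    exact h ⊥ x (by simp [nabla])
  · intro h a b hab
    have key : ∀ y, θ.rel y (y ⊔ x) := fun y => by simpa using θ.sup_rel (θ.refl y) h
    have hab : a ⊔ x = b ⊔ x := hab
    exact θ.trans (key a) (hab ▸ θ.symm (key b))

theorem nabla_mono {x y : L} (h : x ≤ y) : nabla x ≤ nabla y := by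
  rw [nabla_le_iff]
  simp [nabla, h]

theorem nabla_inf (x y : L) : nabla (x ⊓ y) = nabla x ⊓ nabla y := by
  refine le_antisymm (le_inf (nabla_mono inf_le_left) (nabla_mono inf_le_right)) ?_
  rintro a b ⟨h, h'⟩
  show a ⊔ x ⊓ y = b ⊔ x ⊓ y
  rw [sup_inf_left, sup_inf_left]
  exact congrArg₂ (· ⊓ ·) h h'

theorem nabla_sSup (S : Set L) : nabla (sSup S) = sSup (nabla '' S) := by
  apply le_antisymm
  · rw [nabla_le_iff]
    have := (sSup (nabla '' S)).sSup_rel ((fun x => (⊥, x)) '' S) (by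
      rintro _ ⟨x, hx, rfl⟩
      exact (nabla_le_iff x _).1 (le_sSup ⟨x, hx, rfl⟩))
    rw [Set.image_image, Set.image_image] at this
    simp only [Set.image_id'] at this
    convert this using 1
    exact (bot_unique (sSup_le (by rintro _ ⟨_, _, rfl⟩; exact le_rfl))).symm
  · refine sSup_le ?_
    rintro _ ⟨x, hx, rfl⟩
    exact nabla_mono (le_sSup hx)

theorem delta_bot : delta (⊥ : L) = ⊤ := by
  refine top_unique fun a b _ => ?_
  simp [delta]

theorem delta_anti {x y : L} (h : x ≤ y) : delta y ≤ delta x := by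
  intro a b hab
  have hab : a ⊓ y = b ⊓ y := hab
  show a ⊓ x = b ⊓ x
  rw [← inf_eq_right.2 h, ← inf_assoc, ← inf_assoc, hab]

theorem delta_sup (x y : L) : delta (x ⊔ y) = delta x ⊓ delta y := by
  refine le_antisymm (le_inf (delta_anti le_sup_left) (delta_anti le_sup_right)) ?_
  rintro a b ⟨h, h'⟩
  show a ⊓ (x ⊔ y) = b ⊓ (x ⊔ y)
  rw [inf_sup_left, inf_sup_left]
  exact congrArg₂ (· ⊔ ·) h h'

theorem delta_inf (x y : L) : delta (x ⊓ y) = delta x ⊔ delta y := by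
  apply le_antisymm
  · intro a b hab
    have hab : a ⊓ (x ⊓ y) = b ⊓ (x ⊓ y) := hab
    have key : ∀ z, (delta x ⊔ delta y).rel z (z ⊓ (x ⊓ y)) := fun z =>
      (delta x ⊔ delta y).trans
        ((le_sup_left : delta x ≤ delta x ⊔ delta y) z (z ⊓ x) (by simp [delta]))
        ((le_sup_right : delta y ≤ delta x ⊔ delta y) (z ⊓ x) (z ⊓ (x ⊓ y)) (by
          simp [delta, inf_assoc]))
    exact (delta x ⊔ delta y).trans (key a) (hab ▸ (delta x ⊔ delta y).symm (key b))
  · exact sup_le (delta_anti inf_le_left) (delta_anti inf_le_right)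

/-- The congruence generated by a relation `R`: the smallest congruence for which `[a] ≤ [b]`
holds in the quotient whenever `(a, b) ∈ R`. -/
def gen (R : Set (L × L)) : FrameCongr L :=
  sInf {θ | ∀ p ∈ R, θ.rel (p.1 ⊓ p.2) p.1}

/-- The restriction of a congruence along a frame map. -/
def comap {M : Type v} [Order.Frame M] (f : FrameHom M L) (θ : FrameCongr L) : FrameCongr M where
  rel a b := θ.rel (f a) (f b)
  refl _ := θ.refl _
  symm h := θ.symm h
  trans h h' := θ.trans h h'
  inf_rel h h' := by simpa only [map_inf] using θ.inf_rel h h'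
  sSup_rel S hS := by
    have := θ.sSup_rel ((fun p : M × M => (f p.1, f p.2)) '' S) (by
      rintro _ ⟨p, hp, rfl⟩
      exact hS p hp)
    simpa only [map_sSup, Set.image_image] using this

/-- The kernel congruence of a frame map. -/
def ker {M : Type v} [Order.Frame M] (f : FrameHom L M) : FrameCongr L where
  rel a b := f a = f b
  refl _ := rfl
  symm h := Eq.symm h
  trans h h' := Eq.trans h h'
  inf_rel h h' := by rw [map_inf, map_inf, h, h']
  sSup_rel S hS := by
    rw [map_sSup, map_sSup, Set.image_image, Set.image_image,
      Set.image_congr (g := fun p : L × L => f p.2) hS]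

/-- The equivalence relation underlying a congruence. -/
def setoid (θ : FrameCongr L) : Setoid L where
  r := θ.rel
  iseqv := ⟨θ.refl, θ.symm, θ.trans⟩

/-- The quotient frame `L/θ`. -/
def Quo (θ : FrameCongr L) : Type u := Quotient θ.setoid

/-- The class of `a` in `L/θ`. -/
def cls (θ : FrameCongr L) (a : L) : θ.Quo := Quotient.mk θ.setoid a

variable (θ : FrameCongr L)

theorem cls_eq_iff {a b : L} : θ.cls a = θ.cls b ↔ θ.rel a b :=
  Quotient.eq (r := θ.setoid)

theorem cls_surjective : Function.Surjective θ.cls := Quotient.mk_surjective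

instance : Min θ.Quo where
  min := Quotient.map₂ (· ⊓ ·) fun _ _ h _ _ h' => θ.inf_rel h h'

theorem cls_inf (a b : L) : θ.cls (a ⊓ b) = θ.cls a ⊓ θ.cls b := rfl

instance : PartialOrder θ.Quo where
  le x y := x ⊓ y = x
  le_refl x := by
    obtain ⟨a, rfl⟩ := θ.cls_surjective x
    rw [← cls_inf, inf_idem]
  le_trans x y z h h' := by
    obtain ⟨a, rfl⟩ := θ.cls_surjective x
    obtain ⟨b, rfl⟩ := θ.cls_surjective y
    obtain ⟨c, rfl⟩ := θ.cls_surjective z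
    rw [← cls_inf] at h h' ⊢
    rw [cls_eq_iff] at h h' ⊢
    have h1 := θ.inf_rel h (θ.refl c)
    have h2 := θ.inf_rel (θ.refl a) h'
    rw [← inf_assoc] at h2
    exact θ.trans (θ.symm h1) (θ.trans h2 h)
  le_antisymm x y h h' := by
    obtain ⟨a, rfl⟩ := θ.cls_surjective x
    obtain ⟨b, rfl⟩ := θ.cls_surjective y
    rw [← cls_inf] at h h'
    rw [inf_comm] at h'
    exact h.symm.trans h'

theorem cls_le_iff {a b : L} : θ.cls a ≤ θ.cls b ↔ θ.rel (a ⊓ b) a := by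
  rw [← cls_eq_iff, cls_inf]
  rfl

theorem cls_mono {a b : L} (h : a ≤ b) : θ.cls a ≤ θ.cls b := by
  rw [cls_le_iff, inf_eq_left.2 h]
  exact θ.refl a

theorem cls_sSup_le {S : Set L} {b : L} (h : ∀ a ∈ S, θ.cls a ≤ θ.cls b) :
    θ.cls (sSup S) ≤ θ.cls b := by
  rw [cls_le_iff]
  have := θ.sSup_rel ((fun a => (a ⊓ b, a)) '' S) (by
    rintro _ ⟨a, ha, rfl⟩
    exact θ.cls_le_iff.1 (h a ha))
  rw [Set.image_image, Set.image_image] at this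
  simp only [Set.image_id'] at this
  rwa [sSup_inf_eq, ← sSup_image]

instance : SupSet θ.Quo where
  sSup T := θ.cls (sSup {a | θ.cls a ∈ T})

theorem isLUB_sSup (T : Set θ.Quo) : IsLUB T (sSup T) := by
  constructor
  · intro x hx
    obtain ⟨a, rfl⟩ := θ.cls_surjective x
    exact θ.cls_mono (le_sSup hx)
  · intro y hy
    obtain ⟨b, rfl⟩ := θ.cls_surjective y
    exact θ.cls_sSup_le fun a ha => hy ha

instance : CompleteLattice θ.Quo where
  __ := completeLatticeOfSup θ.Quo θ.isLUB_sSup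
  top := θ.cls ⊤
  le_top x := by
    obtain ⟨a, rfl⟩ := θ.cls_surjective x
    exact θ.cls_mono le_top
  inf := (· ⊓ ·)
  inf_le_left x y := by
    obtain ⟨a, rfl⟩ := θ.cls_surjective x
    obtain ⟨b, rfl⟩ := θ.cls_surjective y
    exact θ.cls_mono inf_le_left
  inf_le_right x y := by
    obtain ⟨a, rfl⟩ := θ.cls_surjective x
    obtain ⟨b, rfl⟩ := θ.cls_surjective y
    exact θ.cls_mono inf_le_right
  le_inf x y z h h' := by
    obtain ⟨a, rfl⟩ := θ.cls_surjective x
    obtain ⟨b, rfl⟩ := θ.cls_surjective y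
    obtain ⟨c, rfl⟩ := θ.cls_surjective z
    rw [← cls_inf]
    rw [cls_le_iff] at h h' ⊢
    have := θ.inf_rel h h'
    rwa [← inf_inf_distrib_left, inf_idem] at this

theorem cls_sSup (S : Set L) : θ.cls (sSup S) = sSup (θ.cls '' S) := by
  apply le_antisymm
  · obtain ⟨b, hb⟩ := θ.cls_surjective (sSup (θ.cls '' S))
    rw [← hb]
    refine θ.cls_sSup_le fun a ha => ?_
    rw [hb]
    exact le_sSup ⟨a, ha, rfl⟩
  · refine sSup_le ?_
    rintro _ ⟨a, ha, rfl⟩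
    exact θ.cls_mono (le_sSup ha)

instance : Order.Frame θ.Quo :=
  .ofMinimalAxioms
    { inf_sSup_le_iSup_inf := fun x T => by
        obtain ⟨a, rfl⟩ := θ.cls_surjective x
        show θ.cls (a ⊓ sSup {b | θ.cls b ∈ T}) ≤ _
        rw [inf_sSup_eq, ← sSup_image, cls_sSup]
        refine sSup_le ?_
        rintro _ ⟨_, ⟨b, hb, rfl⟩, rfl⟩
        rw [cls_inf]
        exact le_iSup₂_of_le (f := fun y (_ : y ∈ T) => θ.cls a ⊓ y) _ hb le_rfl }

/-- The quotient map `L → L/θ`. -/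
def quoMap : FrameHom L θ.Quo where
  toFun := θ.cls
  map_inf' := θ.cls_inf
  map_top' := rfl
  map_sSup' := θ.cls_sSup

/-- The frame map `M/θ' → L/θ` induced by `f : M → L`, where `θ'` is the restriction of `θ`. -/
def quoComapMap {M : Type v} [Order.Frame M] (f : FrameHom M L) :
    FrameHom (θ.comap f).Quo θ.Quo where
  toFun := Quotient.lift (s := (θ.comap f).setoid) (fun a => θ.cls (f a))
    fun _ _ h => θ.cls_eq_iff.2 h
  map_inf' x y := by
    obtain ⟨a, rfl⟩ := (θ.comap f).cls_surjective x
    obtain ⟨b, rfl⟩ := (θ.comap f).cls_surjective y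
    show θ.cls (f (a ⊓ b)) = θ.cls (f a) ⊓ θ.cls (f b)
    rw [map_inf, cls_inf]
  map_top' := by
    show θ.cls (f ⊤) = θ.cls ⊤
    rw [map_top]
  map_sSup' T := by
    have hT : T = (θ.comap f).cls '' {a | (θ.comap f).cls a ∈ T} :=
      (Set.image_preimage_eq T (θ.comap f).cls_surjective).symm
    show θ.cls (f (sSup {a | (θ.comap f).cls a ∈ T})) = _
    conv_rhs => rw [hT]
    rw [map_sSup, cls_sSup, Set.image_image]
    refine congrArg SupSet.sSup (Set.ext fun x => ⟨?_, ?_⟩)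
    · rintro ⟨a, ha, rfl⟩
      exact ⟨_, ⟨a, ha, rfl⟩, rfl⟩
    · rintro ⟨_, ⟨a, ha, rfl⟩, rfl⟩
      exact ⟨a, ha, rfl⟩

theorem quoComapMap_injective {M : Type v} [Order.Frame M] (f : FrameHom M L) :
    Function.Injective (θ.quoComapMap f) := by
  intro x y h
  obtain ⟨a, rfl⟩ := (θ.comap f).cls_surjective x
  obtain ⟨b, rfl⟩ := (θ.comap f).cls_surjective y
  exact (θ.comap f).cls_eq_iff.2 (θ.cls_eq_iff.1 h)

end FrameCongr

/-! ### Coproducts of frames -/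

/-- The frame coproduct `A ⊕ B`, realized as the collection of all sets `U ⊆ A × B` that are
downwards closed and closed under joins in each of the two variables; such a set represents the
element `⨆ (a, b) ∈ U, a ⊓ b`. -/
structure FrameCoprod (A : Type u) (B : Type v) [Order.Frame A] [Order.Frame B] where
  carrier : Set (A × B)
  lower : ∀ {a a' b b'}, a' ≤ a → b' ≤ b → (a, b) ∈ carrier → (a', b') ∈ carrier
  sSup_left : ∀ (S : Set A) (b : B), (∀ a ∈ S, (a, b) ∈ carrier) → (sSup S, b) ∈ carrier
  sSup_right : ∀ (a : A) (S : Set B), (∀ b ∈ S, (a, b) ∈ carrier) → (a, sSup S) ∈ carrier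

namespace FrameCoprod

variable {A : Type u} {B : Type v} [Order.Frame A] [Order.Frame B]

theorem carrier_injective : Function.Injective (carrier : FrameCoprod A B → Set (A × B)) := by
  rintro ⟨U, _, _, _⟩ ⟨V, _, _, _⟩ h
  cases h
  rfl

instance : PartialOrder (FrameCoprod A B) where
  le U V := U.carrier ⊆ V.carrier
  le_refl _ := subset_rfl
  le_trans _ _ _ h h' := h.trans h'
  le_antisymm _ _ h h' := carrier_injective (h.antisymm h')

instance : InfSet (FrameCoprod A B) where
  sInf T :=
    { carrier := {p | ∀ U ∈ T, p ∈ U.carrier}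
      lower := fun ha hb h U hU => U.lower ha hb (h U hU)
      sSup_left := fun S b h U hU => U.sSup_left S b fun a ha => h a ha U hU
      sSup_right := fun a S h U hU => U.sSup_right a S fun b hb => h b hb U hU }

instance : Min (FrameCoprod A B) where
  min U V :=
    { carrier := U.carrier ∩ V.carrier
      lower := fun ha hb h => ⟨U.lower ha hb h.1, V.lower ha hb h.2⟩
      sSup_left := fun S b h =>
        ⟨U.sSup_left S b fun a ha => (h a ha).1, V.sSup_left S b fun a ha => (h a ha).2⟩
      sSup_right := fun a S h =>
        ⟨U.sSup_right a S fun b hb => (h b hb).1, V.sSup_right a S fun b hb => (h b hb).2⟩ }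

instance : Top (FrameCoprod A B) where
  top :=
    { carrier := Set.univ
      lower := fun _ _ _ => trivial
      sSup_left := fun _ _ _ => trivial
      sSup_right := fun _ _ _ => trivial }

theorem isGLB_sInf (T : Set (FrameCoprod A B)) : IsGLB T (sInf T) :=
  ⟨fun U hU _ h => h U hU, fun _ hV _ h _ hU => hV hU h⟩

instance : CompleteLattice (FrameCoprod A B) where
  __ := completeLatticeOfInf (FrameCoprod A B) isGLB_sInf
  top := ⊤
  le_top U := Set.subset_univ U.carrier
  inf := (· ⊓ ·)
  inf_le_left _ _ := Set.inter_subset_left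
  inf_le_right _ _ := Set.inter_subset_right
  le_inf _ _ _ h h' := Set.subset_inter h h'

/-- The Heyting implication of the coproduct. -/
def imp (U V : FrameCoprod A B) : FrameCoprod A B where
  carrier := {p | ∀ q ∈ U.carrier, (p.1 ⊓ q.1, p.2 ⊓ q.2) ∈ V.carrier}
  lower := fun ha hb h q hq =>
    V.lower (inf_le_inf_right _ ha) (inf_le_inf_right _ hb) (h q hq)
  sSup_left := fun S b h q hq => by
    show (sSup S ⊓ q.1, b ⊓ q.2) ∈ V.carrier
    rw [sSup_inf_eq, ← sSup_image]
    refine V.sSup_left _ _ ?_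
    rintro _ ⟨a, ha, rfl⟩
    exact h a ha q hq
  sSup_right := fun a S h q hq => by
    show (a ⊓ q.1, sSup S ⊓ q.2) ∈ V.carrier
    rw [sSup_inf_eq, ← sSup_image]
    refine V.sSup_right _ _ ?_
    rintro _ ⟨b, hb, rfl⟩
    exact h b hb q hq

theorem le_imp_iff (W U V : FrameCoprod A B) : W ≤ imp U V ↔ W ⊓ U ≤ V := by
  constructor
  · rintro h p ⟨hW, hU⟩
    simpa using h hW p hU
  · intro h p hp q hq
    exact h ⟨W.lower inf_le_left inf_le_left hp, U.lower inf_le_right inf_le_right hq⟩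

instance : Order.Frame (FrameCoprod A B) := frameOfImp imp le_imp_iff

theorem bot_left_mem (U : FrameCoprod A B) (b : B) : (⊥, b) ∈ U.carrier := by
  simpa using U.sSup_left ∅ b (by simp)

theorem bot_right_mem (U : FrameCoprod A B) (a : A) : (a, ⊥) ∈ U.carrier := by
  simpa using U.sSup_right a ∅ (by simp)

/-- The image of `a` in `A ⊕ B`. -/
def inlSet (a : A) : FrameCoprod A B where
  carrier := {p | p.1 ≤ a ∨ p.2 = ⊥}
  lower := by
    rintro x x' y y' hx hy (h | h)
    · exact Or.inl (hx.trans h)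
    · exact Or.inr (le_bot_iff.1 (hy.trans h.le))
  sSup_left := fun S y h => by
    by_cases hy : y = ⊥
    · exact Or.inr hy
    · exact Or.inl (sSup_le fun x hx => (h x hx).resolve_right hy)
  sSup_right := fun x S h => by
    by_cases hx : x ≤ a
    · exact Or.inl hx
    · exact Or.inr (sSup_eq_bot.2 fun y hy => (h y hy).resolve_left hx)

/-- The coproduct injection `A → A ⊕ B`. -/
def inl : FrameHom A (FrameCoprod A B) where
  toFun := inlSet
  map_inf' a b := by
    apply carrier_injective
    ext p
    show (p.1 ≤ a ⊓ b ∨ p.2 = ⊥) ↔ (p.1 ≤ a ∨ p.2 = ⊥) ∧ (p.1 ≤ b ∨ p.2 = ⊥)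
    rw [le_inf_iff]
    tauto
  map_top' := by
    apply carrier_injective
    ext p
    exact ⟨fun _ => trivial, fun _ => Or.inl le_top⟩
  map_sSup' S := by
    apply le_antisymm
    · rintro ⟨x, y⟩ (h | h)
      · refine FrameCoprod.lower _ h le_rfl (FrameCoprod.sSup_left _ S y fun a ha => ?_)
        exact (le_sSup (Set.mem_image_of_mem inlSet ha) : inlSet a ≤ _) (Or.inl le_rfl)
      · cases (h : y = ⊥)
        exact bot_right_mem _ x
    · refine sSup_le ?_
      rintro _ ⟨a, ha, rfl⟩ p (h | h)
      · exact Or.inl (h.trans (le_sSup ha))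
      · exact Or.inr h

/-- The image of `b` in `A ⊕ B`. -/
def inrSet (b : B) : FrameCoprod A B where
  carrier := {p | p.2 ≤ b ∨ p.1 = ⊥}
  lower := by
    rintro x x' y y' hx hy (h | h)
    · exact Or.inl (hy.trans h)
    · exact Or.inr (le_bot_iff.1 (hx.trans h.le))
  sSup_left := fun S y h => by
    by_cases hy : y ≤ b
    · exact Or.inl hy
    · exact Or.inr (sSup_eq_bot.2 fun x hx => (h x hx).resolve_left hy)
  sSup_right := fun x S h => by
    by_cases hx : x = ⊥
    · exact Or.inr hx
    · exact Or.inl (sSup_le fun y hy => (h y hy).resolve_right hx)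

/-- The coproduct injection `B → A ⊕ B`. -/
def inr : FrameHom B (FrameCoprod A B) where
  toFun := inrSet
  map_inf' a b := by
    apply carrier_injective
    ext p
    show (p.2 ≤ a ⊓ b ∨ p.1 = ⊥) ↔ (p.2 ≤ a ∨ p.1 = ⊥) ∧ (p.2 ≤ b ∨ p.1 = ⊥)
    rw [le_inf_iff]
    tauto
  map_top' := by
    apply carrier_injective
    ext p
    exact ⟨fun _ => trivial, fun _ => Or.inl le_top⟩
  map_sSup' S := by
    apply le_antisymm
    · rintro ⟨x, y⟩ (h | h)
      · refine FrameCoprod.lower _ le_rfl h (FrameCoprod.sSup_right _ x S fun b hb => ?_)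
        exact (le_sSup (Set.mem_image_of_mem inrSet hb) : inrSet b ≤ _) (Or.inl le_rfl)
      · cases (h : x = ⊥)
        exact bot_left_mem _ y
    · refine sSup_le ?_
      rintro _ ⟨b, hb, rfl⟩ p (h | h)
      · exact Or.inl (h.trans (le_sSup hb))
      · exact Or.inr h

theorem mem_inl {a : A} {p : A × B} : p ∈ (inl a : FrameCoprod A B).carrier ↔ p.1 ≤ a ∨ p.2 = ⊥ :=
  Iff.rfl

theorem mem_inr {b : B} {p : A × B} : p ∈ (inr b : FrameCoprod A B).carrier ↔ p.2 ≤ b ∨ p.1 = ⊥ :=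
  Iff.rfl

theorem inl_inf_inr_le_iff {a : A} {b : B} {U : FrameCoprod A B} :
    inl a ⊓ inr b ≤ U ↔ (a, b) ∈ U.carrier := by
  constructor
  · intro h
    exact h ⟨Or.inl le_rfl, Or.inl le_rfl⟩
  · rintro h ⟨x, y⟩ ⟨h1, h2⟩
    rw [mem_inl] at h1
    rw [mem_inr] at h2
    rcases h1 with h1 | h1
    · rcases h2 with h2 | h2
      · exact U.lower h1 h2 h
      · cases (h2 : x = ⊥)
        exact U.bot_left_mem y
    · cases (h1 : y = ⊥)
      exact U.bot_right_mem x

theorem eq_iSup (U : FrameCoprod A B) : U = ⨆ p ∈ U.carrier, inl p.1 ⊓ inr p.2 := by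
  apply le_antisymm
  · intro p hp
    refine inl_inf_inr_le_iff.1 ?_
    exact le_iSup₂_of_le (f := fun (p : A × B) (_ : p ∈ U.carrier) =>
      (inl p.1 ⊓ inr p.2 : FrameCoprod A B)) p hp le_rfl
  · exact iSup₂_le fun p hp => inl_inf_inr_le_iff.2 hp

theorem inl_injective (h : Nontrivial A → Nontrivial B) :
    Function.Injective (inl : FrameHom A (FrameCoprod A B)) := by
  rcases subsingleton_or_nontrivial A with hA | hA
  · exact fun _ _ _ => Subsingleton.elim _ _
  · have := h hA
    have key : ∀ a b : A, (inl a : FrameCoprod A B) ≤ inl b → a ≤ b := fun a b hab =>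
      (mem_inl.1 (hab (mem_inl.2 (Or.inl le_rfl) : (a, (⊤ : B)) ∈ _))).resolve_right top_ne_bot
    exact fun a b hab => le_antisymm (key a b hab.le) (key b a hab.ge)

theorem inr_injective (h : Nontrivial B → Nontrivial A) :
    Function.Injective (inr : FrameHom B (FrameCoprod A B)) := by
  rcases subsingleton_or_nontrivial B with hB | hB
  · exact fun _ _ _ => Subsingleton.elim _ _
  · have := h hB
    have key : ∀ a b : B, (inr a : FrameCoprod A B) ≤ inr b → a ≤ b := fun a b hab =>
      (mem_inr.1 (hab (mem_inr.2 (Or.inl le_rfl) : ((⊤ : A), a) ∈ _))).resolve_right top_ne_bot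
    exact fun a b hab => le_antisymm (key a b hab.le) (key b a hab.ge)

theorem nontrivial_iff : Nontrivial (FrameCoprod A B) ↔ Nontrivial A ∧ Nontrivial B := by
  constructor
  · intro h
    by_contra hc
    refine not_subsingleton (FrameCoprod A B) ⟨fun U V => ?_⟩
    have key : ∀ W : FrameCoprod A B, W = ⊤ := fun W => by
      refine top_unique ?_
      rintro ⟨a, b⟩ _
      rcases subsingleton_or_nontrivial A with hA | hA
      · rw [Subsingleton.elim a ⊥]
        exact W.bot_left_mem b
      · rcases subsingleton_or_nontrivial B with hB | hB
        · rw [Subsingleton.elim b ⊥]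
          exact W.bot_right_mem a
        · exact absurd ⟨hA, hB⟩ hc
    rw [key U, key V]
  · rintro ⟨hA, hB⟩
    exact (inl_injective fun _ => hB).nontrivial

variable {M : Type w} [Order.Frame M]

/-- The coproduct pairing `A ⊕ B → M` of two frame maps. -/
def desc (f : FrameHom A M) (g : FrameHom B M) : FrameHom (FrameCoprod A B) M where
  toFun U := ⨆ p ∈ U.carrier, f p.1 ⊓ g p.2
  map_inf' U V := by
    apply le_antisymm
    · refine le_inf ?_ ?_
      · exact iSup₂_le fun p hp => le_iSup₂_of_le p hp.1 le_rfl
      · exact iSup₂_le fun p hp => le_iSup₂_of_le p hp.2 le_rfl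
    · rw [iSup₂_inf_eq]
      refine iSup₂_le fun p hp => ?_
      rw [inf_iSup₂_eq]
      refine iSup₂_le fun q hq => le_iSup₂_of_le (p.1 ⊓ q.1, p.2 ⊓ q.2)
        ⟨U.lower inf_le_left inf_le_left hp, V.lower inf_le_right inf_le_right hq⟩ ?_
      simp only [map_inf]
      exact (inf_inf_inf_comm _ _ _ _).le
  map_top' := by
    refine top_unique ?_
    refine le_iSup₂_of_le ((⊤ : A), (⊤ : B)) trivial ?_
    simp
  map_sSup' T := by
    apply le_antisymm
    · have key : sSup T ≤
          (⟨{p | f p.1 ⊓ g p.2 ≤ ⨆ U ∈ T, ⨆ p ∈ U.carrier, f p.1 ⊓ g p.2},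
            fun ha hb h => (inf_le_inf (OrderHomClass.mono f ha) (OrderHomClass.mono g hb)).trans h,
            fun S b h => by
              show f (sSup S) ⊓ g b ≤ _
              rw [map_sSup, sSup_inf_eq, iSup_image]
              exact iSup₂_le h,
            fun a S h => by
              show f a ⊓ g (sSup S) ≤ _
              rw [map_sSup, inf_sSup_eq, iSup_image]
              exact iSup₂_le h⟩ : FrameCoprod A B) := by
        refine sSup_le fun U hU p hp => ?_
        exact le_iSup₂_of_le (f := fun (U : FrameCoprod A B) (_ : U ∈ T) =>
          ⨆ p ∈ U.carrier, f p.1 ⊓ g p.2) U hU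
          (le_iSup₂_of_le (f := fun (p : A × B) (_ : p ∈ U.carrier) => f p.1 ⊓ g p.2) p hp le_rfl)
      rw [sSup_image]
      exact iSup₂_le fun p hp => key hp
    · refine sSup_le ?_
      rintro _ ⟨U, hU, rfl⟩
      exact iSup₂_le fun p hp => le_iSup₂_of_le (f := fun (p : A × B)
        (_ : p ∈ (sSup T : FrameCoprod A B).carrier) => f p.1 ⊓ g p.2) p (le_sSup hU hp) le_rfl

theorem desc_inl (f : FrameHom A M) (g : FrameHom B M) (a : A) : desc f g (inl a) = f a := by
  apply le_antisymm
  · refine iSup₂_le ?_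
    rintro ⟨x, y⟩ (h | h)
    · exact inf_le_left.trans (OrderHomClass.mono f h)
    · rw [show y = ⊥ from h, map_bot, inf_bot_eq]
      exact bot_le
  · refine le_iSup₂_of_le (a, ⊤) (Or.inl le_rfl) ?_
    simp

theorem desc_inr (f : FrameHom A M) (g : FrameHom B M) (b : B) : desc f g (inr b) = g b := by
  apply le_antisymm
  · refine iSup₂_le ?_
    rintro ⟨x, y⟩ (h | h)
    · exact inf_le_right.trans (OrderHomClass.mono g h)
    · rw [show x = ⊥ from h, map_bot, bot_inf_eq]
      exact bot_le
  · refine le_iSup₂_of_le (⊤, b) (Or.inl le_rfl) ?_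
    simp

end FrameCoprod

/-! ### The filter completion -/

section FilterCompletion

variable {D : Type u} [DistribLattice D] [BoundedOrder D]

instance : InfSet (Order.PFilter D) where
  sInf T := Order.IsPFilter.toPFilter (F := {x | ∀ F ∈ T, x ∈ F})
    (Order.IsPFilter.of_def ⟨⊤, fun _ _ => Order.PFilter.top_mem⟩
      (fun x hx y hy => ⟨x ⊓ y, fun F hF => Order.PFilter.inf_mem (hx F hF) (hy F hF),
        inf_le_left, inf_le_right⟩)
      (fun hxy hx F hF => Order.PFilter.mem_of_le hxy (hx F hF)))

instance : Min (Order.PFilter D) where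
  min F G := Order.IsPFilter.toPFilter (F := {x | x ∈ F ∧ x ∈ G})
    (Order.IsPFilter.of_def ⟨⊤, Order.PFilter.top_mem, Order.PFilter.top_mem⟩
      (fun x hx y hy => ⟨x ⊓ y, ⟨Order.PFilter.inf_mem hx.1 hy.1, Order.PFilter.inf_mem hx.2 hy.2⟩,
        inf_le_left, inf_le_right⟩)
      (fun hxy hx => ⟨Order.PFilter.mem_of_le hxy hx.1, Order.PFilter.mem_of_le hxy hx.2⟩))

/-- The filters of a bounded distributive lattice, ordered by inclusion. -/
instance : CompleteLattice (Order.PFilter D) where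
  __ := completeLatticeOfInf (Order.PFilter D) fun _ =>
    ⟨fun F hF _ h => h F hF, fun _ hG _ h _ hF => hG hF h⟩
  top := ⊤
  le_top _ := le_top
  bot := ⊥
  bot_le _ := bot_le
  inf := (· ⊓ ·)
  inf_le_left _ _ _ h := h.1
  inf_le_right _ _ _ h := h.2
  le_inf _ _ _ h h' _ hx := ⟨h hx, h' hx⟩

/-- The Heyting implication of filters. -/
def filterImp (F G : Order.PFilter D) : Order.PFilter D :=
  Order.IsPFilter.toPFilter (F := {x | ∀ y ∈ F, x ⊔ y ∈ G})
    (Order.IsPFilter.of_def ⟨⊤, fun y _ => by rw [top_sup_eq]; exact Order.PFilter.top_mem⟩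
      (fun x hx y hy => ⟨x ⊓ y, fun z hz => by
        rw [sup_inf_right]; exact Order.PFilter.inf_mem (hx z hz) (hy z hz),
        inf_le_left, inf_le_right⟩)
      (fun hxy hx z hz => Order.PFilter.mem_of_le (sup_le_sup_right hxy z) (hx z hz)))

theorem le_filterImp_iff (H F G : Order.PFilter D) : H ≤ filterImp F G ↔ H ⊓ F ≤ G := by
  constructor
  · rintro h x ⟨hH, hF⟩
    have h1 : x ⊔ x ∈ G := h hH x hF
    rwa [sup_idem] at h1
  · intro h x hx y hy
    exact h ⟨Order.PFilter.mem_of_le le_sup_left hx, Order.PFilter.mem_of_le le_sup_right hy⟩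

/-- The filter completion `F(D)`: the frame of all filters of `D`, ordered by inclusion. -/
instance : Order.Frame (Order.PFilter D) := frameOfImp filterImp le_filterImp_iff

theorem nontrivial_pfilter_iff : Nontrivial (Order.PFilter D) ↔ Nontrivial D := by
  constructor
  · intro h
    by_contra hc
    rw [not_nontrivial_iff_subsingleton] at hc
    refine not_subsingleton (Order.PFilter D) ⟨fun F G => SetLike.ext fun x => ?_⟩
    rw [Subsingleton.elim x ⊤]
    exact iff_of_true Order.PFilter.top_mem Order.PFilter.top_mem
  · intro h
    refine ⟨Order.PFilter.principal (⊤ : D), Order.PFilter.principal ⊥, fun he => ?_⟩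
    have h1 : (⊥ : D) ∈ Order.PFilter.principal (⊤ : D) := by
      rw [he]; exact Order.PFilter.mem_principal.2 le_rfl
    exact bot_ne_top (top_le_iff.1 (Order.PFilter.mem_principal.1 h1))

end FilterCompletion

/-! ### Biframes -/

/-- A biframe `(L⁺, L⁻, L)`: three frames with frame injections `e⁺ : L⁺ → L`, `e⁻ : L⁻ → L` such
that every element of `L` is of the form `⨆ i, e⁺ xᵢ ⊓ e⁻ yᵢ`. -/
structure Biframe where
  pos : Type u
  neg : Type u
  main : Type u
  [framePos : Order.Frame pos]
  [frameNeg : Order.Frame neg]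
  [frameMain : Order.Frame main]
  ePos : FrameHom pos main
  eNeg : FrameHom neg main
  ePos_injective : Function.Injective ePos
  eNeg_injective : Function.Injective eNeg
  generated : ∀ x : main, ∃ S : Set (pos × neg), x = ⨆ p ∈ S, ePos p.1 ⊓ eNeg p.2

namespace Biframe

attribute [instance] framePos frameNeg frameMain

/-- A biframe map: a pair of frame maps `f⁺`, `f⁻` for which there is a compatible frame map
between the main components. -/
@[ext]
structure Hom (L M : Biframe.{u}) where
  pos : FrameHom L.pos M.pos
  neg : FrameHom L.neg M.neg
  exists_main : ∃ f : FrameHom L.main M.main,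
    (∀ x, f (L.ePos x) = M.ePos (pos x)) ∧ (∀ x, f (L.eNeg x) = M.eNeg (neg x))

/-- The category of biframes. -/
instance : Category Biframe.{u} where
  Hom := Hom
  id L := ⟨FrameHom.id _, FrameHom.id _, FrameHom.id _, fun _ => rfl, fun _ => rfl⟩
  comp f g :=
    { pos := g.pos.comp f.pos
      neg := g.neg.comp f.neg
      exists_main := by
        obtain ⟨f', hf, hf'⟩ := f.exists_main
        obtain ⟨g', hg, hg'⟩ := g.exists_main
        refine ⟨g'.comp f', fun x => ?_, fun x => ?_⟩
        · show g' (f' _) = _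
          rw [hf, hg]
          rfl
        · show g' (f' _) = _
          rw [hf', hg']
          rfl }

theorem nontrivial_pos_iff (L : Biframe.{u}) : Nontrivial L.pos ↔ Nontrivial L.main := by
  refine ⟨fun h => L.ePos_injective.nontrivial, fun h => ⟨⊥, ⊤, fun he => ?_⟩⟩
  have := congrArg L.ePos he
  rw [map_bot, map_top] at this
  exact bot_ne_top this

theorem nontrivial_neg_iff (L : Biframe.{u}) : Nontrivial L.neg ↔ Nontrivial L.main := by
  refine ⟨fun h => L.eNeg_injective.nontrivial, fun h => ⟨⊥, ⊤, fun he => ?_⟩⟩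
  have := congrArg L.eNeg he
  rw [map_bot, map_top] at this
  exact bot_ne_top this

/-- The biframe quotient `L/R = (L⁺/C⁺, L⁻/C⁻, L/C)` by a relation `R` on the main component,
where `C` is the congruence generated by `R` and `C⁺`, `C⁻` are its restrictions. -/
def quotient (L : Biframe.{u}) (R : Set (L.main × L.main)) : Biframe.{u} where
  pos := ((FrameCongr.gen R).comap L.ePos).Quo
  neg := ((FrameCongr.gen R).comap L.eNeg).Quo
  main := (FrameCongr.gen R).Quo
  ePos := (FrameCongr.gen R).quoComapMap L.ePos
  eNeg := (FrameCongr.gen R).quoComapMap L.eNeg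
  ePos_injective := (FrameCongr.gen R).quoComapMap_injective L.ePos
  eNeg_injective := (FrameCongr.gen R).quoComapMap_injective L.eNeg
  generated x := by
    obtain ⟨a, rfl⟩ := (FrameCongr.gen R).cls_surjective x
    obtain ⟨S, hS⟩ := L.generated a
    refine ⟨(fun p => (((FrameCongr.gen R).comap L.ePos).cls p.1,
      ((FrameCongr.gen R).comap L.eNeg).cls p.2)) '' S, ?_⟩
    rw [iSup_image]
    show (FrameCongr.gen R).quoMap a = _
    conv_lhs => rw [hS]
    simp only [map_iSup]
    rfl

/-- The class in `(L/R)⁺` of an element of `L⁺`. -/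
def quotientPos (L : Biframe.{u}) (R : Set (L.main × L.main)) :
    FrameHom L.pos (L.quotient R).pos :=
  FrameCongr.quoMap _

/-- The class in `(L/R)⁻` of an element of `L⁻`. -/
def quotientNeg (L : Biframe.{u}) (R : Set (L.main × L.main)) :
    FrameHom L.neg (L.quotient R).neg :=
  FrameCongr.quoMap _

/-! ### The assembly of a biframe -/

/-- The finitary elements: finite joins of elements `e⁺ x ⊓ e⁻ y`. -/
def finitary (L : Biframe.{u}) : Set L.main :=
  {x | ∃ s : Finset (L.pos × L.neg), x = s.sup fun p => L.ePos p.1 ⊓ L.eNeg p.2}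

theorem ePos_mem_finitary (L : Biframe.{u}) (x : L.pos) : L.ePos x ∈ L.finitary :=
  ⟨{(x, ⊤)}, by simp⟩

theorem eNeg_mem_finitary (L : Biframe.{u}) (x : L.neg) : L.eNeg x ∈ L.finitary :=
  ⟨{(⊤, x)}, by simp⟩

/-- The finitary assembly: the subframe of the assembly of the main component generated by all
`∇(x)` and by `Δ(s)` for finitary `s`. -/
def finAssembly (L : Biframe.{u}) : Subframe (FrameCongr L.main) :=
  Subframe.closure
    ({c | ∃ x : L.main, c = FrameCongr.nabla x} ∪
      {c | ∃ s ∈ L.finitary, c = FrameCongr.delta s})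

/-- `∇(x)` as an element of the finitary assembly. -/
def finNabla (L : Biframe.{u}) (x : L.main) : L.finAssembly.Elt :=
  ⟨FrameCongr.nabla x, Subframe.subset_closure _ (Or.inl ⟨x, rfl⟩)⟩

/-- `Δ(s)`, for finitary `s`, as an element of the finitary assembly. -/
def finDelta (L : Biframe.{u}) (s : L.main) (hs : s ∈ L.finitary) : L.finAssembly.Elt :=
  ⟨FrameCongr.delta s, Subframe.subset_closure _ (Or.inr ⟨s, hs, rfl⟩)⟩

/-- The subframe of the finitary assembly generated by `∇(x⁺)`, `Δ(x⁻)`. -/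
def assemblyPos (L : Biframe.{u}) : Subframe L.finAssembly.Elt :=
  Subframe.closure
    (Set.range (fun x : L.pos => L.finNabla (L.ePos x)) ∪
      Set.range (fun x : L.neg => L.finDelta (L.eNeg x) (L.eNeg_mem_finitary x)))

/-- The subframe of the finitary assembly generated by `∇(x⁻)`, `Δ(x⁺)`. -/
def assemblyNeg (L : Biframe.{u}) : Subframe L.finAssembly.Elt :=
  Subframe.closure
    (Set.range (fun x : L.neg => L.finNabla (L.eNeg x)) ∪
      Set.range (fun x : L.pos => L.finDelta (L.ePos x) (L.ePos_mem_finitary x)))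

theorem assembly_generated (L : Biframe.{u}) (c : L.finAssembly.Elt) :
    c ∈ (meetJoinSubframe L.assemblyPos.incl L.assemblyNeg.incl).carrier := by
  -- the same elements, viewed in the full assembly
  let K := meetJoinSubframe (L.finAssembly.incl.comp L.assemblyPos.incl)
    (L.finAssembly.incl.comp L.assemblyNeg.incl)
  have hpos : ∀ d ∈ L.assemblyPos.carrier, d.1 ∈ K.carrier := fun d hd =>
    left_mem_meetJoinSubframe (L.finAssembly.incl.comp L.assemblyPos.incl)
      (L.finAssembly.incl.comp L.assemblyNeg.incl) ⟨d, hd⟩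
  have hneg : ∀ d ∈ L.assemblyNeg.carrier, d.1 ∈ K.carrier := fun d hd =>
    right_mem_meetJoinSubframe (L.finAssembly.incl.comp L.assemblyPos.incl)
      (L.finAssembly.incl.comp L.assemblyNeg.incl) ⟨d, hd⟩
  have sup_mem : ∀ a ∈ K.carrier, ∀ b ∈ K.carrier, a ⊔ b ∈ K.carrier := fun a ha b hb => by
    rw [← sSup_pair]
    exact K.sSup_mem _ (by rintro x (rfl | rfl) <;> assumption)
  have nP : ∀ x, FrameCongr.nabla (L.ePos x) ∈ K.carrier := fun x =>
    hpos (L.finNabla (L.ePos x)) (Subframe.subset_closure _ (Or.inl ⟨x, rfl⟩))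
  have nN : ∀ x, FrameCongr.nabla (L.eNeg x) ∈ K.carrier := fun x =>
    hneg (L.finNabla (L.eNeg x)) (Subframe.subset_closure _ (Or.inl ⟨x, rfl⟩))
  have dP : ∀ x, FrameCongr.delta (L.ePos x) ∈ K.carrier := fun x =>
    hneg (L.finDelta (L.ePos x) (L.ePos_mem_finitary x))
      (Subframe.subset_closure _ (Or.inr ⟨x, rfl⟩))
  have dN : ∀ x, FrameCongr.delta (L.eNeg x) ∈ K.carrier := fun x =>
    hpos (L.finDelta (L.eNeg x) (L.eNeg_mem_finitary x))
      (Subframe.subset_closure _ (Or.inr ⟨x, rfl⟩))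
  have hK : c.1 ∈ K.carrier := by
    refine c.2 K ?_
    rintro _ (⟨x, rfl⟩ | ⟨s, ⟨t, rfl⟩, rfl⟩)
    · obtain ⟨S, rfl⟩ := L.generated x
      rw [← sSup_image, FrameCongr.nabla_sSup]
      refine K.sSup_mem _ ?_
      rintro _ ⟨_, ⟨p, _, rfl⟩, rfl⟩
      show FrameCongr.nabla (L.ePos p.1 ⊓ L.eNeg p.2) ∈ K.carrier
      rw [FrameCongr.nabla_inf]
      exact K.inf_mem (nP _) (nN _)
    · classical
      induction t using Finset.induction_on with
      | empty =>
        rw [Finset.sup_empty, FrameCongr.delta_bot]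
        exact K.top_mem
      | insert p t _ ih =>
        rw [Finset.sup_insert, FrameCongr.delta_sup, FrameCongr.delta_inf]
        exact K.inf_mem (sup_mem _ (dP _) _ (dN _)) ih
  obtain ⟨S, hS⟩ := hK
  refine ⟨S, L.finAssembly.incl_injective ?_⟩
  simp only [map_iSup]
  exact hS

/-- The assembly `A(L)` of a biframe `L`. -/
def assembly (L : Biframe.{u}) : Biframe.{u} where
  pos := L.assemblyPos.Elt
  neg := L.assemblyNeg.Elt
  main := L.finAssembly.Elt
  ePos := L.assemblyPos.incl
  eNeg := L.assemblyNeg.incl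
  ePos_injective := L.assemblyPos.incl_injective
  eNeg_injective := L.assemblyNeg.incl_injective
  generated := L.assembly_generated

/-- `∇(x⁺)`, a positive element of the assembly. -/
def nablaPos (L : Biframe.{u}) (x : L.pos) : L.assembly.pos :=
  ⟨L.finNabla (L.ePos x), Subframe.subset_closure _ (Or.inl ⟨x, rfl⟩)⟩

/-- `Δ(x⁻)`, a positive element of the assembly. -/
def deltaNeg (L : Biframe.{u}) (x : L.neg) : L.assembly.pos :=
  ⟨L.finDelta (L.eNeg x) (L.eNeg_mem_finitary x), Subframe.subset_closure _ (Or.inr ⟨x, rfl⟩)⟩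

/-- `∇(x⁻)`, a negative element of the assembly. -/
def nablaNeg (L : Biframe.{u}) (x : L.neg) : L.assembly.neg :=
  ⟨L.finNabla (L.eNeg x), Subframe.subset_closure _ (Or.inl ⟨x, rfl⟩)⟩

/-- `Δ(x⁺)`, a negative element of the assembly. -/
def deltaPos (L : Biframe.{u}) (x : L.pos) : L.assembly.neg :=
  ⟨L.finDelta (L.ePos x) (L.ePos_mem_finitary x), Subframe.subset_closure _ (Or.inr ⟨x, rfl⟩)⟩

/-! ### The free construction -/

/-- The biframe `(L⁺ ⊕ F(L⁻), L⁻ ⊕ F(L⁺), L⁺ ⊕ F(L⁻) ⊕ L⁻ ⊕ F(L⁺))`. -/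
def freeAssembly (L : Biframe.{u}) : Biframe.{u} where
  pos := FrameCoprod L.pos (Order.PFilter L.neg)
  neg := FrameCoprod L.neg (Order.PFilter L.pos)
  main := FrameCoprod (FrameCoprod L.pos (Order.PFilter L.neg))
    (FrameCoprod L.neg (Order.PFilter L.pos))
  ePos := FrameCoprod.inl
  eNeg := FrameCoprod.inr
  ePos_injective := FrameCoprod.inl_injective (by
    simp only [FrameCoprod.nontrivial_iff, nontrivial_pfilter_iff]
    exact fun h => ⟨h.2, h.1⟩)
  eNeg_injective := FrameCoprod.inr_injective (by
    simp only [FrameCoprod.nontrivial_iff, nontrivial_pfilter_iff]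
    exact fun h => ⟨h.2, h.1⟩)
  generated U := ⟨U.carrier, U.eq_iSup⟩

/-- The generator `x⁺ ∈ L⁺`, in the positive component `L⁺ ⊕ F(L⁻)`. -/
def genPos (L : Biframe.{u}) (x : L.pos) : L.freeAssembly.pos :=
  FrameCoprod.inl x

/-- The generator `↑x⁻ ∈ F(L⁻)`, in the positive component `L⁺ ⊕ F(L⁻)`. -/
def upNeg (L : Biframe.{u}) (x : L.neg) : L.freeAssembly.pos :=
  FrameCoprod.inr (Order.PFilter.principal x)

/-- The generator `x⁻ ∈ L⁻`, in the negative component `L⁻ ⊕ F(L⁺)`. -/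
def genNeg (L : Biframe.{u}) (x : L.neg) : L.freeAssembly.neg :=
  FrameCoprod.inl x

/-- The generator `↑x⁺ ∈ F(L⁺)`, in the negative component `L⁻ ⊕ F(L⁺)`. -/
def upPos (L : Biframe.{u}) (x : L.pos) : L.freeAssembly.neg :=
  FrameCoprod.inr (Order.PFilter.principal x)

/-- The congruence `C_L` on `L⁺ ⊕ L⁻` with `(L⁺ ⊕ L⁻)/C_L ≅ L`: the kernel of the coproduct
pairing of `e⁺` and `e⁻`. -/
def congrC (L : Biframe.{u}) : FrameCongr (FrameCoprod L.pos L.neg) :=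
  FrameCongr.ker (FrameCoprod.desc L.ePos L.eNeg)

/-- The canonical map `L⁺ ⊕ L⁻ → L⁺ ⊕ F(L⁻) ⊕ L⁻ ⊕ F(L⁺)`. -/
def coprodToFree (L : Biframe.{u}) : FrameHom (FrameCoprod L.pos L.neg) L.freeAssembly.main :=
  FrameCoprod.desc
    (L.freeAssembly.ePos.comp
      (FrameCoprod.inl : FrameHom L.pos (FrameCoprod L.pos (Order.PFilter L.neg))))
    (L.freeAssembly.eNeg.comp
      (FrameCoprod.inl : FrameHom L.neg (FrameCoprod L.neg (Order.PFilter L.pos))))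

/-- `C_L`, regarded as a relation on `L⁺ ⊕ F(L⁻) ⊕ L⁻ ⊕ F(L⁺)`. -/
def relC (L : Biframe.{u}) : Set (L.freeAssembly.main × L.freeAssembly.main) :=
  {p | ∃ a b, L.congrC.rel a b ∧ p = (L.coprodToFree a, L.coprodToFree b)}

/-- The pairs `(x⁺ ⊓ ↑x⁺, 0)` and `(1, x⁺ ⊔ ↑x⁺)`, for `x⁺ ∈ L⁺`. -/
def relComPos (L : Biframe.{u}) : Set (L.freeAssembly.main × L.freeAssembly.main) :=
  {p | ∃ x : L.pos,
    p = (L.freeAssembly.ePos (L.genPos x) ⊓ L.freeAssembly.eNeg (L.upPos x), ⊥) ∨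
    p = (⊤, L.freeAssembly.ePos (L.genPos x) ⊔ L.freeAssembly.eNeg (L.upPos x))}

/-- The pairs `(x⁻ ⊓ ↑x⁻, 0)` and `(1, x⁻ ⊔ ↑x⁻)`, for `x⁻ ∈ L⁻`. -/
def relComNeg (L : Biframe.{u}) : Set (L.freeAssembly.main × L.freeAssembly.main) :=
  {p | ∃ x : L.neg,
    p = (L.freeAssembly.eNeg (L.genNeg x) ⊓ L.freeAssembly.ePos (L.upNeg x), ⊥) ∨
    p = (⊤, L.freeAssembly.eNeg (L.genNeg x) ⊔ L.freeAssembly.ePos (L.upNeg x))}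

/-- The relation `C_L ∪ Com⁺_L ∪ Com⁻_L`. -/
def assemblyRel (L : Biframe.{u}) : Set (L.freeAssembly.main × L.freeAssembly.main) :=
  L.relC ∪ L.relComPos ∪ L.relComNeg

end Biframe

/-!
The isomorphism comes from a frame map `Φ` from the free construction to the finitary assembly, and
a frame map `Ψ` from the finitary assembly to the quotient `Q` of the free construction.

The closed congruences `∇(x)` define frame maps on `L⁺` and `L⁻`. The open congruences reverse
order and exchange finite meets with finite joins, so `F ↦ ⨆ x ∈ F, Δ(x)` defines frame maps on the
filter frames (`PFilter.lift`). Pairing these gives `Φ` (`assemblyMap`), which respects the defining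
relations because `∇` is a frame map on `L` and `Δ(x)` is the complement of `∇(x)`
(`gen_assemblyRel_le_ker`).

In the other direction, the relations `C_L` give a frame map `j : L → Q` with `j (e⁺ x) = [x]` and
`j (e⁻ x) = [x]`, and the relations `Com` make `j s` complemented for each finitary `s`. Such a map
extends to the finitary assembly (`FrameCongr.exists_extension`). Indeed, every element of the
finitary assembly is a join of congruences `∇(x) ⊓ Δ(s)` with `s` finitary. For `m : Q` let `θ_m` be
the congruence `j a ⊔ m = j b ⊔ m`. Then
`∇(x) ⊓ Δ(s) ≤ θ_m ↔ j x ≤ j s ⊔ m ↔ j x ⊓ (j s)ᶜ ≤ m`, so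
`Ψ θ = ⨆ {j x ⊓ (j s)ᶜ | ∇(x) ⊓ Δ(s) ≤ θ}` is left adjoint to `m ↦ θ_m` on the finitary assembly and
preserves joins; the finite meets are computed on the generators.

Both `Ψ ∘ Φ` and the quotient map take the same values on generators, so they agree. Hence the kernel
of `Φ` is exactly the congruence of the quotient. The positive and negative parts of `Φ` are
surjective, since their ranges contain the generators, so they induce the required isomorphism. It is
unique because its values on generators of the two parts are prescribed.
-/

/-! ### Frame maps, generators and surjections -/

namespace Subframe

variable {L : Type u} {M : Type v} [Order.Frame L] [Order.Frame M]

/-- The range of a frame map. -/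
def range (f : FrameHom L M) : Subframe M where
  carrier := Set.range f
  top_mem := ⟨⊤, map_top f⟩
  inf_mem := by
    rintro _ _ ⟨a, rfl⟩ ⟨b, rfl⟩
    exact ⟨a ⊓ b, map_inf f a b⟩
  sSup_mem := fun S hS => ⟨sSup (f ⁻¹' S), by rw [map_sSup, Set.image_preimage_eq_of_subset hS]⟩

/-- The subframe on which two frame maps agree. -/
def equalizer (f g : FrameHom L M) : Subframe L where
  carrier := {x | f x = g x}
  top_mem := by simp
  inf_mem := fun {a b} (ha : f a = g a) (hb : f b = g b) => by
    show f (a ⊓ b) = g (a ⊓ b)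
    rw [map_inf, map_inf, ha, hb]
  sSup_mem := fun S hS => by
    show f (sSup S) = g (sSup S)
    rw [map_sSup, map_sSup, Set.image_congr hS]

/-- The image in `L` of a subframe of a subframe of `L`. -/
def map (K : Subframe L) (T : Subframe K.Elt) : Subframe L where
  carrier := {x | ∃ h : x ∈ K.carrier, (⟨x, h⟩ : K.Elt) ∈ T.carrier}
  top_mem := ⟨K.top_mem, T.top_mem⟩
  inf_mem := fun ⟨ha, ha'⟩ ⟨hb, hb'⟩ => ⟨K.inf_mem ha hb, T.inf_mem ha' hb'⟩
  sSup_mem := fun S hS => by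
    have h := T.sSup_mem {y | y.1 ∈ S} fun y hy => (hS hy).2
    have he : Subtype.val '' {y : K.Elt | y.1 ∈ S} = S :=
      Set.Subset.antisymm (by rintro _ ⟨y, hy, rfl⟩; exact hy)
        fun x hx => ⟨⟨x, (hS hx).1⟩, hx, rfl⟩
    have hv : (sSup {y : K.Elt | y.1 ∈ S}).1 = sSup S := congrArg sSup he
    have hm : sSup S ∈ K.carrier := hv ▸ (sSup {y : K.Elt | y.1 ∈ S}).2
    have hs : (⟨sSup S, hm⟩ : K.Elt) = sSup {y : K.Elt | y.1 ∈ S} := Subtype.ext hv.symm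
    exact ⟨hm, hs ▸ h⟩

theorem mem_of_generators_mem {S : Set L} (T : Subframe (closure S).Elt)
    (h : ∀ x (hx : x ∈ S), (⟨x, subset_closure S hx⟩ : (closure S).Elt) ∈ T.carrier)
    (x : (closure S).Elt) : x ∈ T.carrier :=
  (x.2 ((closure S).map T) fun y hy => ⟨subset_closure S hy, h y hy⟩).2

end Subframe

/-- A frame map factors through a surjective frame map whose kernel is smaller. -/
theorem FrameHom.exists_factor {A : Type u} {B : Type v} {M : Type w} [Order.Frame A]
    [Order.Frame B] [Order.Frame M] (p : FrameHom A B) (hp : Function.Surjective p)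
    (g : FrameHom A M) (h : ∀ a b, p a = p b → g a = g b) :
    ∃ f : FrameHom B M, ∀ a, f (p a) = g a := by
  have hs : ∀ a, g (Function.surjInv hp (p a)) = g a := fun a =>
    h _ _ (Function.surjInv_eq hp (p a))
  refine ⟨{ toFun := fun b => g (Function.surjInv hp b), map_inf' := ?_, map_top' := ?_,
            map_sSup' := ?_ }, hs⟩
  · intro x y
    rw [← map_inf]
    exact h _ _ (by simp only [map_inf, Function.surjInv_eq hp])
  · rw [← map_top g]
    exact h _ _ (by rw [Function.surjInv_eq hp, map_top])
  · intro S
    show g _ = sSup ((fun b => g (Function.surjInv hp b)) '' S)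
    rw [← Set.image_image (fun a => g a) (Function.surjInv hp), ← map_sSup]
    refine h _ _ ?_
    rw [map_sSup, Set.image_image]
    simp only [Function.surjInv_eq hp, Set.image_id']

theorem FrameCoprod.hom_ext {A : Type u} {B : Type v} {M : Type w} [Order.Frame A]
    [Order.Frame B] [Order.Frame M] {f g : FrameHom (FrameCoprod A B) M}
    (hl : ∀ a, f (inl a) = g (inl a)) (hr : ∀ b, f (inr b) = g (inr b)) : f = g := by
  ext U
  rw [U.eq_iSup]
  simp only [map_iSup, map_inf, hl, hr]

/-! ### Frame maps out of a frame of filters -/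

namespace Order.PFilter

variable {D : Type u} [DistribLattice D] [BoundedOrder D] {M : Type v} [Order.Frame M]

theorem eq_iSup_principal (F : PFilter D) : F = ⨆ x ∈ F, principal x :=
  le_antisymm (fun x hx => (le_iSup₂_of_le (f := fun (x : D) (_ : x ∈ F) => principal x)
      x hx le_rfl : principal x ≤ _) (mem_principal.2 le_rfl))
    (iSup₂_le fun _ hx _ hy => mem_of_le (mem_principal.1 hy) hx)

theorem coprod_hom_ext {A : Type w} [Frame A] {f g : FrameHom (FrameCoprod A (PFilter D)) M}
    (hl : ∀ a, f (FrameCoprod.inl a) = g (FrameCoprod.inl a))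
    (hr : ∀ x, f (FrameCoprod.inr (principal x)) = g (FrameCoprod.inr (principal x))) :
    f = g := by
  refine FrameCoprod.hom_ext hl fun F => ?_
  rw [F.eq_iSup_principal]
  simp only [map_iSup, hr]

/-- The frame map `F ↦ ⨆ x ∈ F, d x` on filters induced by a map `d` which reverses the lattice
operations. -/
def lift (d : D → M) (htop : d ⊤ = ⊥) (hbot : d ⊥ = ⊤) (hinf : ∀ x y, d (x ⊓ y) = d x ⊔ d y)
    (hsup : ∀ x y, d (x ⊔ y) = d x ⊓ d y) : FrameHom (PFilter D) M where
  toFun F := ⨆ x ∈ F, d x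
  map_inf' F G := by
    apply le_antisymm
    · refine iSup₂_le fun x hx => le_inf ?_ ?_
      · exact le_iSup₂_of_le x hx.1 le_rfl
      · exact le_iSup₂_of_le x hx.2 le_rfl
    · rw [iSup₂_inf_eq]
      refine iSup₂_le fun x hx => ?_
      rw [inf_iSup₂_eq]
      refine iSup₂_le fun y hy => ?_
      rw [← hsup]
      exact le_iSup₂_of_le (f := fun (z : D) (_ : z ∈ F ⊓ G) => d z) (x ⊔ y)
        ⟨mem_of_le le_sup_left hx, mem_of_le le_sup_right hy⟩ le_rfl
  map_top' := top_unique (hbot.symm.le.trans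
    (le_iSup₂_of_le (f := fun (x : D) (_ : x ∈ (⊤ : PFilter D)) => d x) ⊥ trivial le_rfl))
  map_sSup' T := by
    apply le_antisymm
    · -- the elements sent below the right-hand side form a filter containing every member of `T`
      have hanti : ∀ {x y}, x ≤ y → d y ≤ d x := fun {x y} hxy => by
        rw [← inf_eq_left.2 hxy, hinf]; exact le_sup_right
      let G : PFilter D := IsPFilter.toPFilter
        (F := {x | d x ≤ sSup ((fun F : PFilter D => ⨆ x ∈ F, d x) '' T)})
        (IsPFilter.of_def ⟨⊤, htop.le.trans bot_le⟩
          (fun x hx y hy => ⟨x ⊓ y, (hinf x y).le.trans (sup_le hx hy), inf_le_left, inf_le_right⟩)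
          (fun hxy hx => (hanti hxy).trans hx))
      have hG : sSup T ≤ G := sSup_le fun F hF x hx =>
        (le_iSup₂_of_le (f := fun (x : D) (_ : x ∈ F) => d x) x hx le_rfl).trans
          (le_sSup (Set.mem_image_of_mem _ hF))
      exact iSup₂_le fun x hx => hG hx
    · refine sSup_le ?_
      rintro _ ⟨F, hF, rfl⟩
      exact iSup₂_le fun x hx => le_iSup₂_of_le (f := fun (x : D) (_ : x ∈ sSup T) => d x) x
        (le_sSup hF hx) le_rfl

theorem lift_principal (d : D → M) (htop : d ⊤ = ⊥) (hbot : d ⊥ = ⊤)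
    (hinf : ∀ x y, d (x ⊓ y) = d x ⊔ d y) (hsup : ∀ x y, d (x ⊔ y) = d x ⊓ d y) (x : D) :
    lift d htop hbot hinf hsup (principal x) = d x :=
  le_antisymm
    (iSup₂_le fun y hy => by
      rw [← inf_eq_left.2 (mem_principal.1 hy), hinf]; exact le_sup_right)
    (le_iSup₂_of_le (f := fun (y : D) (_ : y ∈ principal x) => d y) x
      (mem_principal.2 le_rfl) le_rfl)

end Order.PFilter

/-! ### Extending frame maps to congruences -/

namespace FrameCongr

variable {L : Type u} [Order.Frame L] {M : Type v} [Order.Frame M]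

theorem nabla_top : nabla (⊤ : L) = ⊤ := top_unique fun a b _ => by simp [nabla]

theorem delta_top : delta (⊤ : L) = ⊥ := bot_unique fun a b h => by
  have h : a ⊓ ⊤ = b ⊓ ⊤ := h
  rw [inf_top_eq, inf_top_eq] at h
  exact h ▸ refl _ a

theorem isCompl_nabla_delta (x : L) : IsCompl (nabla x) (delta x) := by
  refine ⟨disjoint_iff_inf_le.2 ?_, codisjoint_iff_le_sup.2 ?_⟩
  · rintro a b ⟨h, h'⟩
    have h : a ⊔ x = b ⊔ x := h
    have h' : a ⊓ x = b ⊓ x := h'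
    have hab : a = b := eq_of_inf_eq_sup_eq h' h
    exact hab ▸ refl _ a
  · have h1 : (nabla x ⊔ delta x).rel ⊥ x := (nabla_le_iff x _).1 le_sup_left
    have h2 : (nabla x ⊔ delta x).rel x ⊤ :=
      (le_sup_right : delta x ≤ nabla x ⊔ delta x) x ⊤ (by simp [delta])
    rw [← nabla_top, nabla_le_iff]
    exact (nabla x ⊔ delta x).trans h1 h2

/-- `∇(x) ⊓ Δ(s)` is the least congruence identifying `s` with `x ⊔ s`. -/
theorem nabla_inf_delta_le_iff (x s : L) (θ : FrameCongr L) :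
    nabla x ⊓ delta s ≤ θ ↔ θ.rel (x ⊔ s) s := by
  constructor
  · intro h
    refine h _ _ ⟨?_, ?_⟩
    · show x ⊔ s ⊔ x = s ⊔ x
      rw [sup_right_comm, sup_idem, sup_comm]
    · show (x ⊔ s) ⊓ s = s ⊓ s
      simp
  · rintro h a b ⟨h1, h2⟩
    have h1 : a ⊔ x = b ⊔ x := h1
    have h2 : a ⊓ s = b ⊓ s := h2
    -- used for `(a, b)` and `(b, a)`, where the right-hand sides agree since `a ⊓ s = b ⊓ s`
    have key : ∀ y z : L, y ≤ z ⊔ x → θ.rel y ((y ⊓ z) ⊔ (y ⊓ s)) := fun y z hy => by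
      have h3 := θ.sup_rel (θ.refl (y ⊓ z)) (θ.inf_rel (θ.refl y) h)
      have h4 : y ⊓ z ⊔ y ⊓ (x ⊔ s) = y := by
        rw [← inf_sup_left, inf_eq_left]
        exact hy.trans (sup_le_sup_left le_sup_left z)
      rwa [h4] at h3
    have ha := key a b (h1 ▸ le_sup_left)
    have hb := key b a (h1 ▸ le_sup_left)
    rw [inf_comm b a, ← h2] at hb
    exact θ.trans ha (θ.symm hb)

/-- For a set `S` closed under finite joins, the congruences which are joins of congruences
`∇(x) ⊓ Δ(s)` with `s ∈ S`. Membership is expressed by the universal property of the join of all the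
`∇(x) ⊓ Δ(s)` below `θ`. -/
def joinSubframe (S : Set L) (hbot : ⊥ ∈ S) (hsup : ∀ s ∈ S, ∀ t ∈ S, s ⊔ t ∈ S) :
    Subframe (FrameCongr L) where
  carrier := {θ | ∀ φ, (∀ x, ∀ s ∈ S, nabla x ⊓ delta s ≤ θ → nabla x ⊓ delta s ≤ φ) → θ ≤ φ}
  top_mem := fun φ h => by
    have := h ⊤ ⊥ hbot le_top
    rwa [nabla_top, delta_bot, inf_idem] at this
  inf_mem := fun {θ θ'} hθ hθ' φ h => by
    rw [← le_imp_iff]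
    refine hθ _ fun x s hs hxs => ?_
    rw [le_imp_iff, inf_comm, ← le_imp_iff]
    refine hθ' _ fun y t ht hyt => ?_
    rw [le_imp_iff]
    have he : nabla y ⊓ delta t ⊓ (nabla x ⊓ delta s) = nabla (y ⊓ x) ⊓ delta (t ⊔ s) := by
      rw [nabla_inf, delta_sup, inf_inf_inf_comm]
    rw [he]
    refine h _ _ (hsup t ht s hs) ?_
    rw [← he]
    exact le_inf (inf_le_right.trans hxs) (inf_le_left.trans hyt)
  sSup_mem := fun T hT φ h => sSup_le fun θ hθ =>
    hT hθ φ fun x s hs hxs => h x s hs (hxs.trans (le_sSup hθ))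

theorem mem_joinSubframe_of_mem_closure {S : Set L} (hbot : ⊥ ∈ S)
    (hsup : ∀ s ∈ S, ∀ t ∈ S, s ⊔ t ∈ S) {θ : FrameCongr L}
    (hθ : θ ∈ (Subframe.closure
      ({c | ∃ x : L, c = nabla x} ∪ {c | ∃ s ∈ S, c = delta s})).carrier) :
    θ ∈ (joinSubframe S hbot hsup).carrier := by
  refine hθ _ ?_
  rintro _ (⟨x, rfl⟩ | ⟨s, hs, rfl⟩) φ h
  · have := h x ⊥ hbot inf_le_left
    rwa [delta_bot, inf_top_eq] at this
  · have := h ⊤ s hs inf_le_right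
    rwa [nabla_top, top_inf_eq] at this

/-- Here `(nabla m).comap j` is the congruence `j a ⊔ m = j b ⊔ m`, the kernel of
`L → M → M/∇(m)`. -/
theorem nabla_inf_delta_le_comap_iff (j : FrameHom L M) {s : L} (hs : IsCompl (j s) (j s)ᶜ) (x : L) (m : M) :
    nabla x ⊓ delta s ≤ (nabla m).comap j ↔ j x ⊓ (j s)ᶜ ≤ m := by
  rw [nabla_inf_delta_le_iff, ← hs.symm.le_sup_right_iff_inf_left_le, sup_comm m]
  show j (x ⊔ s) ⊔ m = j s ⊔ m ↔ _
  rw [map_sup, sup_assoc, sup_eq_right]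

/-- A frame map `j` on `L` which sends every element of `S` to a complemented element extends along
`∇` to the subframe of the assembly generated by all `∇(x)` and the `Δ(s)` with `s ∈ S`. On that
subframe the extension is the left adjoint of `m ↦ (nabla m).comap j`. -/
theorem exists_extension {S : Set L} (hbot : ⊥ ∈ S)
    (hsup : ∀ s ∈ S, ∀ t ∈ S, s ⊔ t ∈ S) (j : FrameHom L M)
    (hj : ∀ s ∈ S, IsCompl (j s) (j s)ᶜ) :
    ∃ Ψ : FrameHom (Subframe.closure
        ({c | ∃ x : L, c = nabla x} ∪ {c | ∃ s ∈ S, c = delta s})).Elt M,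
      (∀ θ x, θ.1 = nabla x → Ψ θ = j x) ∧ ∀ θ, ∀ s ∈ S, θ.1 = delta s → Ψ θ = (j s)ᶜ := by
  set K := Subframe.closure ({c | ∃ x : L, c = nabla x} ∪ {c | ∃ s ∈ S, c = delta s})
  let F : FrameCongr L → M := fun θ =>
    sSup {m | ∃ x, ∃ s ∈ S, nabla x ⊓ delta s ≤ θ ∧ m = j x ⊓ (j s)ᶜ}
  have hF : ∀ θ ∈ K.carrier, ∀ m, F θ ≤ m ↔ θ ≤ (nabla m).comap j := by
    intro θ hθ m
    constructor
    · intro h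
      refine mem_joinSubframe_of_mem_closure hbot hsup hθ _ fun x s hs hxs => ?_
      rw [nabla_inf_delta_le_comap_iff j (hj s hs)]
      have hle : j x ⊓ (j s)ᶜ ≤ F θ := le_sSup ⟨x, s, hs, hxs, rfl⟩
      exact hle.trans h
    · intro h
      refine sSup_le ?_
      rintro _ ⟨x, s, hs, hxs, rfl⟩
      rw [← nabla_inf_delta_le_comap_iff j (hj s hs)]
      exact hxs.trans h
  have nK : ∀ x, nabla x ∈ K.carrier := fun x => Subframe.subset_closure _ (Or.inl ⟨x, rfl⟩)
  have dK : ∀ s ∈ S, delta s ∈ K.carrier := fun s hs =>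
    Subframe.subset_closure _ (Or.inr ⟨s, hs, rfl⟩)
  have hmono : ∀ {θ φ}, θ ≤ φ → F θ ≤ F φ := fun {θ φ} h => sSup_le_sSup (by
    rintro _ ⟨x, s, hs, hxs, rfl⟩
    exact ⟨x, s, hs, hxs.trans h, rfl⟩)
  have hgen : ∀ x, ∀ s ∈ S, F (nabla x ⊓ delta s) = j x ⊓ (j s)ᶜ := fun x s hs =>
    eq_of_forall_ge_iff fun m => by
      rw [hF _ (K.inf_mem (nK x) (dK s hs)), nabla_inf_delta_le_comap_iff j (hj s hs)]
  let Ψ : FrameHom K.Elt M :=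
    { toFun := fun θ => F θ.1
      map_top' := by
        have h : j ⊤ ⊓ (j ⊥)ᶜ ≤ F ⊤ := le_sSup ⟨⊤, ⊥, hbot, le_top, rfl⟩
        rw [map_top, map_bot, compl_bot, inf_idem] at h
        exact top_unique h
      map_inf' := fun θ φ => by
        refine le_antisymm (le_inf (hmono inf_le_left) (hmono inf_le_right)) ?_
        show sSup _ ⊓ sSup _ ≤ F (θ.1 ⊓ φ.1)
        rw [sSup_inf_sSup]
        refine iSup₂_le ?_
        rintro ⟨_, _⟩ ⟨⟨x, s, hs, hxs, rfl⟩, y, t, ht, hyt, rfl⟩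
        have he : nabla x ⊓ delta s ⊓ (nabla y ⊓ delta t) = nabla (x ⊓ y) ⊓ delta (s ⊔ t) := by
          rw [nabla_inf, delta_sup, inf_inf_inf_comm]
        refine le_sSup ⟨x ⊓ y, s ⊔ t, hsup s hs t ht, he ▸ inf_le_inf hxs hyt, ?_⟩
        rw [map_inf, map_sup, compl_sup, inf_inf_inf_comm]
      map_sSup' := fun T => eq_of_forall_ge_iff fun m => by
        show F (sSup T).1 ≤ m ↔ _
        rw [hF _ (sSup T).2, sSup_le_iff]
        show K.incl (sSup T) ≤ _ ↔ _
        rw [map_sSup, sSup_le_iff, Set.forall_mem_image, Set.forall_mem_image]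
        exact forall₂_congr fun θ _ => (hF θ.1 θ.2 m).symm }
  refine ⟨Ψ, fun θ x hθ => ?_, fun θ s hs hθ => ?_⟩
  · show F θ.1 = _
    have := hgen x ⊥ hbot
    rwa [delta_bot, inf_top_eq, map_bot, compl_bot, inf_top_eq, ← hθ] at this
  · show F θ.1 = _
    have := hgen ⊤ s hs
    rwa [nabla_top, top_inf_eq, map_top, top_inf_eq, ← hθ] at this

theorem cls_le_of_mem {R : Set (L × L)} {p : L × L} (hp : p ∈ R) :
    (gen R).quoMap p.1 ≤ (gen R).quoMap p.2 :=
  (gen R).cls_le_iff.2 fun _ hθ => hθ p hp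

theorem gen_le_ker {R : Set (L × L)} (f : FrameHom L M) (h : ∀ p ∈ R, f p.1 ≤ f p.2) :
    gen R ≤ ker f :=
  fun _ _ hab => hab (ker f) fun p hp => by
    show f (p.1 ⊓ p.2) = f p.1
    rw [map_inf, inf_eq_left.2 (h p hp)]

end FrameCongr

/-! ### The map from the free construction to the assembly -/

namespace Biframe

open FrameCongr

variable (L : Biframe.{u})

theorem bot_mem_finitary : ⊥ ∈ L.finitary := ⟨∅, rfl⟩

theorem sup_mem_finitary : ∀ s ∈ L.finitary, ∀ t ∈ L.finitary, s ⊔ t ∈ L.finitary := by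
  classical
  rintro _ ⟨s, rfl⟩ _ ⟨t, rfl⟩
  exact ⟨s ∪ t, Finset.sup_union.symm⟩

/-- The frame map `∇ : L → A_fin(L)`. -/
def finNablaHom : FrameHom L.main L.assembly.main where
  toFun := L.finNabla
  map_inf' x y := Subtype.ext (nabla_inf x y)
  map_top' := Subtype.ext nabla_top
  map_sSup' S := L.finAssembly.incl_injective
    ((nabla_sSup S).trans (congrArg sSup (Set.image_image Subtype.val L.finNabla S)).symm)

/-- The frame map `L⁺ → A(L)⁺` given by `∇`. -/
def nablaPosHom : FrameHom L.pos L.assembly.pos where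
  toFun := L.nablaPos
  map_inf' x y := L.assembly.ePos_injective
    (map_inf (L.finNablaHom.comp L.ePos) x y)
  map_top' := L.assembly.ePos_injective (map_top (L.finNablaHom.comp L.ePos))
  map_sSup' S := L.assembly.ePos_injective (by
    rw [map_sSup, Set.image_image]
    exact map_sSup (L.finNablaHom.comp L.ePos) S)

/-- The frame map `L⁻ → A(L)⁻` given by `∇`. -/
def nablaNegHom : FrameHom L.neg L.assembly.neg where
  toFun := L.nablaNeg
  map_inf' x y := L.assembly.eNeg_injective
    (map_inf (L.finNablaHom.comp L.eNeg) x y)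
  map_top' := L.assembly.eNeg_injective (map_top (L.finNablaHom.comp L.eNeg))
  map_sSup' S := L.assembly.eNeg_injective (by
    rw [map_sSup, Set.image_image]
    exact map_sSup (L.finNablaHom.comp L.eNeg) S)

/-- The inclusion of `A(L)⁺` into the assembly of the frame `L`. -/
def posIncl : FrameHom L.assembly.pos (FrameCongr L.main) :=
  L.finAssembly.incl.comp L.assemblyPos.incl

/-- The inclusion of `A(L)⁻` into the assembly of the frame `L`. -/
def negIncl : FrameHom L.assembly.neg (FrameCongr L.main) :=
  L.finAssembly.incl.comp L.assemblyNeg.incl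

theorem posIncl_injective : Function.Injective L.posIncl :=
  L.finAssembly.incl_injective.comp L.assemblyPos.incl_injective

theorem negIncl_injective : Function.Injective L.negIncl :=
  L.finAssembly.incl_injective.comp L.assemblyNeg.incl_injective

theorem posIncl_deltaNeg (x : L.neg) : L.posIncl (L.deltaNeg x) = delta (L.eNeg x) := rfl

theorem negIncl_deltaPos (x : L.pos) : L.negIncl (L.deltaPos x) = delta (L.ePos x) := rfl

/-- The frame map `F(L⁻) → A(L)⁺` given by `Δ`. -/
def deltaNegHom : FrameHom (Order.PFilter L.neg) L.assembly.pos :=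
  Order.PFilter.lift L.deltaNeg
    (L.posIncl_injective (by rw [posIncl_deltaNeg, map_top, map_bot, delta_top]))
    (L.posIncl_injective (by rw [posIncl_deltaNeg, map_top, map_bot, delta_bot]))
    (fun x y => L.posIncl_injective (by simp only [map_sup, posIncl_deltaNeg, map_inf, delta_inf]))
    (fun x y => L.posIncl_injective (by simp only [map_sup, posIncl_deltaNeg, map_inf, delta_sup]))

/-- The frame map `F(L⁺) → A(L)⁻` given by `Δ`. -/
def deltaPosHom : FrameHom (Order.PFilter L.pos) L.assembly.neg :=
  Order.PFilter.lift L.deltaPos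
    (L.negIncl_injective (by rw [negIncl_deltaPos, map_top, map_bot, delta_top]))
    (L.negIncl_injective (by rw [negIncl_deltaPos, map_top, map_bot, delta_bot]))
    (fun x y => L.negIncl_injective (by simp only [map_sup, negIncl_deltaPos, map_inf, delta_inf]))
    (fun x y => L.negIncl_injective (by simp only [map_sup, negIncl_deltaPos, map_inf, delta_sup]))

/-- The frame map `L⁺ ⊕ F(L⁻) → A(L)⁺` given by `∇` and `Δ`. -/
def assemblyMapPos : FrameHom L.freeAssembly.pos L.assembly.pos :=
  FrameCoprod.desc L.nablaPosHom L.deltaNegHom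

/-- The frame map `L⁻ ⊕ F(L⁺) → A(L)⁻` given by `∇` and `Δ`. -/
def assemblyMapNeg : FrameHom L.freeAssembly.neg L.assembly.neg :=
  FrameCoprod.desc L.nablaNegHom L.deltaPosHom

/-- The frame map `L⁺ ⊕ F(L⁻) ⊕ L⁻ ⊕ F(L⁺) → A_fin(L)` given by `∇` and `Δ`. -/
def assemblyMap : FrameHom L.freeAssembly.main L.assembly.main :=
  FrameCoprod.desc (L.assembly.ePos.comp L.assemblyMapPos) (L.assembly.eNeg.comp L.assemblyMapNeg)

theorem assemblyMapPos_genPos (x : L.pos) : L.assemblyMapPos (L.genPos x) = L.nablaPos x :=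
  FrameCoprod.desc_inl L.nablaPosHom _ x

theorem assemblyMapPos_upNeg (x : L.neg) : L.assemblyMapPos (L.upNeg x) = L.deltaNeg x :=
  (FrameCoprod.desc_inr L.nablaPosHom L.deltaNegHom _).trans (Order.PFilter.lift_principal ..)

theorem assemblyMapNeg_genNeg (x : L.neg) : L.assemblyMapNeg (L.genNeg x) = L.nablaNeg x :=
  FrameCoprod.desc_inl L.nablaNegHom _ x

theorem assemblyMapNeg_upPos (x : L.pos) : L.assemblyMapNeg (L.upPos x) = L.deltaPos x :=
  (FrameCoprod.desc_inr L.nablaNegHom L.deltaPosHom _).trans (Order.PFilter.lift_principal ..)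

theorem assemblyMap_ePos (a : L.freeAssembly.pos) :
    L.assemblyMap (L.freeAssembly.ePos a) = L.assembly.ePos (L.assemblyMapPos a) :=
  FrameCoprod.desc_inl (L.assembly.ePos.comp L.assemblyMapPos) _ a

theorem assemblyMap_eNeg (a : L.freeAssembly.neg) :
    L.assemblyMap (L.freeAssembly.eNeg a) = L.assembly.eNeg (L.assemblyMapNeg a) :=
  FrameCoprod.desc_inr _ (L.assembly.eNeg.comp L.assemblyMapNeg) a

theorem assemblyMapPos_surjective : Function.Surjective L.assemblyMapPos := by
  refine Subframe.mem_of_generators_mem (Subframe.range L.assemblyMapPos) ?_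
  rintro _ (⟨x, rfl⟩ | ⟨x, rfl⟩)
  · exact ⟨_, L.assemblyMapPos_genPos x⟩
  · exact ⟨_, L.assemblyMapPos_upNeg x⟩

theorem assemblyMapNeg_surjective : Function.Surjective L.assemblyMapNeg := by
  refine Subframe.mem_of_generators_mem (Subframe.range L.assemblyMapNeg) ?_
  rintro _ (⟨x, rfl⟩ | ⟨x, rfl⟩)
  · exact ⟨_, L.assemblyMapNeg_genNeg x⟩
  · exact ⟨_, L.assemblyMapNeg_upPos x⟩

theorem coprodToFree_inl (x : L.pos) :
    L.coprodToFree (FrameCoprod.inl x) = L.freeAssembly.ePos (L.genPos x) :=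
  FrameCoprod.desc_inl (L.freeAssembly.ePos.comp
      (FrameCoprod.inl : FrameHom L.pos (FrameCoprod L.pos (Order.PFilter L.neg)))) _ x

theorem coprodToFree_inr (x : L.neg) :
    L.coprodToFree (FrameCoprod.inr x) = L.freeAssembly.eNeg (L.genNeg x) :=
  FrameCoprod.desc_inr _ (L.freeAssembly.eNeg.comp
      (FrameCoprod.inl : FrameHom L.neg (FrameCoprod L.neg (Order.PFilter L.pos)))) x

/-- On `L⁺ ⊕ L⁻`, the map to the assembly is `∇` of the canonical map to `L`. -/
theorem assemblyMap_coprodToFree (a : FrameCoprod L.pos L.neg) :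
    L.assemblyMap (L.coprodToFree a) = L.finNablaHom (FrameCoprod.desc L.ePos L.eNeg a) := by
  have h : L.assemblyMap.comp L.coprodToFree =
      L.finNablaHom.comp (FrameCoprod.desc L.ePos L.eNeg) := by
    refine FrameCoprod.hom_ext (fun x => ?_) (fun x => ?_)
    · show L.assemblyMap (L.coprodToFree _) = L.finNablaHom (FrameCoprod.desc L.ePos L.eNeg _)
      rw [coprodToFree_inl, assemblyMap_ePos, assemblyMapPos_genPos, FrameCoprod.desc_inl]
      rfl
    · show L.assemblyMap (L.coprodToFree _) = L.finNablaHom (FrameCoprod.desc L.ePos L.eNeg _)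
      rw [coprodToFree_inr, assemblyMap_eNeg, assemblyMapNeg_genNeg, FrameCoprod.desc_inr]
      rfl
  exact DFunLike.congr_fun h a

theorem isCompl_finNabla_finDelta (s : L.main) (hs : s ∈ L.finitary) :
    IsCompl (L.finNabla s) (L.finDelta s hs) := by
  have h := isCompl_nabla_delta s
  refine IsCompl.of_eq (L.finAssembly.incl_injective ?_) (L.finAssembly.incl_injective ?_)
  · rw [map_inf, map_bot]
    exact h.inf_eq_bot
  · rw [map_sup, map_top]
    exact h.sup_eq_top

theorem gen_assemblyRel_le_ker : gen L.assemblyRel ≤ ker L.assemblyMap := by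
  refine gen_le_ker _ ?_
  rintro _ ((⟨a, b, hab, rfl⟩ | ⟨x, rfl | rfl⟩) | ⟨x, rfl | rfl⟩)
  · have hab : FrameCoprod.desc L.ePos L.eNeg a = FrameCoprod.desc L.ePos L.eNeg b := hab
    simp only [assemblyMap_coprodToFree, hab, le_refl]
  · rw [map_inf, assemblyMap_ePos, assemblyMap_eNeg, assemblyMapPos_genPos, assemblyMapNeg_upPos]
    exact (L.isCompl_finNabla_finDelta _ (L.ePos_mem_finitary x)).inf_eq_bot.le.trans bot_le
  · rw [map_sup, assemblyMap_ePos, assemblyMap_eNeg, assemblyMapPos_genPos, assemblyMapNeg_upPos]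
    exact le_top.trans (L.isCompl_finNabla_finDelta _ (L.ePos_mem_finitary x)).sup_eq_top.ge
  · rw [map_inf, assemblyMap_ePos, assemblyMap_eNeg, assemblyMapPos_upNeg, assemblyMapNeg_genNeg]
    exact (L.isCompl_finNabla_finDelta _ (L.eNeg_mem_finitary x)).inf_eq_bot.le.trans bot_le
  · rw [map_sup, assemblyMap_ePos, assemblyMap_eNeg, assemblyMapPos_upNeg, assemblyMapNeg_genNeg]
    exact le_top.trans (L.isCompl_finNabla_finDelta _ (L.eNeg_mem_finitary x)).sup_eq_top.ge

/-! ### The map from the assembly to the quotient -/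

/-- The quotient map of the main component of the free construction. -/
def quotientMain : FrameHom L.freeAssembly.main (L.freeAssembly.quotient L.assemblyRel).main :=
  (gen L.assemblyRel).quoMap

theorem isCompl_genPos_upPos (x : L.pos) :
    IsCompl (L.quotientMain (L.freeAssembly.ePos (L.genPos x)))
      (L.quotientMain (L.freeAssembly.eNeg (L.upPos x))) := by
  refine IsCompl.of_le ?_ ?_
  · rw [← map_inf, ← map_bot L.quotientMain]
    exact cls_le_of_mem
      (p := (L.freeAssembly.ePos (L.genPos x) ⊓ L.freeAssembly.eNeg (L.upPos x), ⊥))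
      (Or.inl (Or.inr ⟨x, Or.inl rfl⟩))
  · rw [← map_sup, ← map_top L.quotientMain]
    exact cls_le_of_mem
      (p := (⊤, L.freeAssembly.ePos (L.genPos x) ⊔ L.freeAssembly.eNeg (L.upPos x)))
      (Or.inl (Or.inr ⟨x, Or.inr rfl⟩))

theorem isCompl_genNeg_upNeg (x : L.neg) :
    IsCompl (L.quotientMain (L.freeAssembly.eNeg (L.genNeg x)))
      (L.quotientMain (L.freeAssembly.ePos (L.upNeg x))) := by
  refine IsCompl.of_le ?_ ?_
  · rw [← map_inf, ← map_bot L.quotientMain]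
    exact cls_le_of_mem
      (p := (L.freeAssembly.eNeg (L.genNeg x) ⊓ L.freeAssembly.ePos (L.upNeg x), ⊥))
      (Or.inr ⟨x, Or.inl rfl⟩)
  · rw [← map_sup, ← map_top L.quotientMain]
    exact cls_le_of_mem
      (p := (⊤, L.freeAssembly.eNeg (L.genNeg x) ⊔ L.freeAssembly.ePos (L.upNeg x)))
      (Or.inr ⟨x, Or.inr rfl⟩)

theorem desc_ePos_eNeg_surjective : Function.Surjective (FrameCoprod.desc L.ePos L.eNeg) := by
  intro x
  obtain ⟨S, rfl⟩ := L.generated x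
  refine ⟨⨆ p ∈ S, FrameCoprod.inl p.1 ⊓ FrameCoprod.inr p.2, ?_⟩
  simp only [map_iSup, map_inf, FrameCoprod.desc_inl, FrameCoprod.desc_inr]

/-- The canonical map `L → Q`, obtained from `(L⁺ ⊕ L⁻)/C_L ≅ L`. -/
theorem exists_mainToQuotient :
    ∃ j : FrameHom L.main (L.freeAssembly.quotient L.assemblyRel).main,
      (∀ x, j (L.ePos x) = L.quotientMain (L.freeAssembly.ePos (L.genPos x))) ∧
      (∀ x, j (L.eNeg x) = L.quotientMain (L.freeAssembly.eNeg (L.genNeg x))) := by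
  have hle : ∀ a b, L.congrC.rel a b →
      L.quotientMain (L.coprodToFree a) ≤ L.quotientMain (L.coprodToFree b) := fun a b h =>
    cls_le_of_mem (p := (L.coprodToFree a, L.coprodToFree b)) (Or.inl (Or.inl ⟨a, b, h, rfl⟩))
  obtain ⟨j, hj⟩ := FrameHom.exists_factor _ L.desc_ePos_eNeg_surjective
    (L.quotientMain.comp L.coprodToFree)
    fun a b h => le_antisymm (hle a b h) (hle b a (Eq.symm h))
  refine ⟨j, fun x => ?_, fun x => ?_⟩
  · rw [← coprodToFree_inl, ← FrameCoprod.desc_inl L.ePos L.eNeg, hj]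
    rfl
  · rw [← coprodToFree_inr, ← FrameCoprod.desc_inr L.ePos L.eNeg, hj]
    rfl

/-- The map `Ψ` from the finitary assembly to the quotient, with `Ψ ∘ Φ` the quotient map. -/
theorem exists_assemblyToQuotient :
    ∃ Ψ : FrameHom L.assembly.main (L.freeAssembly.quotient L.assemblyRel).main,
      ∀ a, Ψ (L.assemblyMap a) = L.quotientMain a := by
  classical
  obtain ⟨j, hjp, hjn⟩ := L.exists_mainToQuotient
  have hj : ∀ s ∈ L.finitary, IsCompl (j s) (j s)ᶜ := by
    rintro _ ⟨t, rfl⟩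
    have hc : IsComplemented (j (t.sup fun p => L.ePos p.1 ⊓ L.eNeg p.2)) := by
      induction t using Finset.induction_on with
      | empty =>
        rw [Finset.sup_empty, map_bot]
        exact isComplemented_bot
      | insert p t _ ih =>
        rw [Finset.sup_insert, map_sup, map_inf, hjp, hjn]
        exact IsComplemented.sup (IsComplemented.inf ⟨_, L.isCompl_genPos_upPos _⟩
          ⟨_, L.isCompl_genNeg_upNeg _⟩) ih
    obtain ⟨c, hc⟩ := hc
    rwa [hc.compl_eq]
  obtain ⟨Ψ, hn, hd⟩ := FrameCongr.exists_extension L.bot_mem_finitary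
    L.sup_mem_finitary j hj
  refine ⟨Ψ, fun a => ?_⟩
  have h : FrameHom.comp (β := L.assembly.main) Ψ L.assemblyMap = L.quotientMain := by
    refine FrameCoprod.hom_ext (fun b => ?_) (fun b => ?_)
    · have h : (FrameHom.comp (β := L.assembly.main) Ψ L.assemblyMap).comp L.freeAssembly.ePos =
          L.quotientMain.comp L.freeAssembly.ePos := by
        refine Order.PFilter.coprod_hom_ext (fun x => ?_) (fun x => ?_)
        · show Ψ (L.assemblyMap (L.freeAssembly.ePos (L.genPos x))) = _
          rw [assemblyMap_ePos, assemblyMapPos_genPos]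
          exact (hn _ (L.ePos x) rfl).trans (hjp x)
        · show Ψ (L.assemblyMap (L.freeAssembly.ePos (L.upNeg x))) = _
          rw [assemblyMap_ePos, assemblyMapPos_upNeg]
          refine (hd _ (L.eNeg x) (L.eNeg_mem_finitary x) rfl).trans ?_
          rw [hjn]
          exact (L.isCompl_genNeg_upNeg x).compl_eq
      exact DFunLike.congr_fun h b
    · have h : (FrameHom.comp (β := L.assembly.main) Ψ L.assemblyMap).comp L.freeAssembly.eNeg =
          L.quotientMain.comp L.freeAssembly.eNeg := by
        refine Order.PFilter.coprod_hom_ext (fun x => ?_) (fun x => ?_)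
        · show Ψ (L.assemblyMap (L.freeAssembly.eNeg (L.genNeg x))) = _
          rw [assemblyMap_eNeg, assemblyMapNeg_genNeg]
          exact (hn _ (L.eNeg x) rfl).trans (hjn x)
        · show Ψ (L.assemblyMap (L.freeAssembly.eNeg (L.upPos x))) = _
          rw [assemblyMap_eNeg, assemblyMapNeg_upPos]
          refine (hd _ (L.ePos x) (L.ePos_mem_finitary x) rfl).trans ?_
          rw [hjp]
          exact (L.isCompl_genPos_upPos x).compl_eq
      exact DFunLike.congr_fun h b
  exact DFunLike.congr_fun h a

/-! ### The isomorphism -/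

theorem assemblyMapPos_eq_iff (a b : L.freeAssembly.pos) :
    L.assemblyMapPos a = L.assemblyMapPos b ↔
      L.freeAssembly.quotientPos L.assemblyRel a = L.freeAssembly.quotientPos L.assemblyRel b := by
  obtain ⟨Ψ, hΨ⟩ := L.exists_assemblyToQuotient
  refine Iff.trans ⟨fun h => ?_, fun h => ?_⟩ (cls_eq_iff _).symm
  · have h' := congrArg (fun z => Ψ (L.assembly.ePos z)) h
    simp only [← assemblyMap_ePos, hΨ] at h'
    exact (cls_eq_iff (gen L.assemblyRel)).1 h'
  · have h' : L.assemblyMap _ = L.assemblyMap _ := L.gen_assemblyRel_le_ker _ _ h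
    rw [assemblyMap_ePos, assemblyMap_ePos] at h'
    exact L.assembly.ePos_injective h'

theorem assemblyMapNeg_eq_iff (a b : L.freeAssembly.neg) :
    L.assemblyMapNeg a = L.assemblyMapNeg b ↔
      L.freeAssembly.quotientNeg L.assemblyRel a = L.freeAssembly.quotientNeg L.assemblyRel b := by
  obtain ⟨Ψ, hΨ⟩ := L.exists_assemblyToQuotient
  refine Iff.trans ⟨fun h => ?_, fun h => ?_⟩ (cls_eq_iff _).symm
  · have h' := congrArg (fun z => Ψ (L.assembly.eNeg z)) h
    simp only [← assemblyMap_eNeg, hΨ] at h'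
    exact (cls_eq_iff (gen L.assemblyRel)).1 h'
  · have h' : L.assemblyMap _ = L.assemblyMap _ := L.gen_assemblyRel_le_ker _ _ h
    rw [assemblyMap_eNeg, assemblyMap_eNeg] at h'
    exact L.assembly.eNeg_injective h'

theorem quotientPos_surjective (R : Set (L.main × L.main)) :
    Function.Surjective (L.quotientPos R) := cls_surjective _

theorem quotientNeg_surjective (R : Set (L.main × L.main)) :
    Function.Surjective (L.quotientNeg R) := cls_surjective _

theorem exists_assemblyIso :
    ∃ i : L.assembly ≅ L.freeAssembly.quotient L.assemblyRel,
      (∀ a, i.hom.pos (L.assemblyMapPos a) = L.freeAssembly.quotientPos L.assemblyRel a) ∧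
      (∀ a, i.hom.neg (L.assemblyMapNeg a) = L.freeAssembly.quotientNeg L.assemblyRel a) := by
  obtain ⟨Ψ, hΨ⟩ := L.exists_assemblyToQuotient
  obtain ⟨Φ, hΦ⟩ := FrameHom.exists_factor L.quotientMain (cls_surjective _) L.assemblyMap
    fun a b h => L.gen_assemblyRel_le_ker a b ((cls_eq_iff _).1 h)
  obtain ⟨fp, hfp⟩ := FrameHom.exists_factor _ L.assemblyMapPos_surjective
    (L.freeAssembly.quotientPos L.assemblyRel) fun a b => (L.assemblyMapPos_eq_iff a b).1
  obtain ⟨fn, hfn⟩ := FrameHom.exists_factor _ L.assemblyMapNeg_surjective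
    (L.freeAssembly.quotientNeg L.assemblyRel) fun a b => (L.assemblyMapNeg_eq_iff a b).1
  obtain ⟨gp, hgp⟩ := FrameHom.exists_factor _ (L.freeAssembly.quotientPos_surjective L.assemblyRel)
    L.assemblyMapPos fun a b => (L.assemblyMapPos_eq_iff a b).2
  obtain ⟨gn, hgn⟩ := FrameHom.exists_factor _ (L.freeAssembly.quotientNeg_surjective L.assemblyRel)
    L.assemblyMapNeg fun a b => (L.assemblyMapNeg_eq_iff a b).2
  refine ⟨⟨⟨fp, fn, Ψ, fun x => ?_, fun x => ?_⟩, ⟨gp, gn, Φ, fun x => ?_, fun x => ?_⟩,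
    Hom.ext (FrameHom.ext fun x => ?_) (FrameHom.ext fun x => ?_),
    Hom.ext (FrameHom.ext fun x => ?_) (FrameHom.ext fun x => ?_)⟩, hfp, hfn⟩
  · obtain ⟨a, rfl⟩ := L.assemblyMapPos_surjective x
    rw [← assemblyMap_ePos, hΨ, hfp]
    rfl
  · obtain ⟨a, rfl⟩ := L.assemblyMapNeg_surjective x
    rw [← assemblyMap_eNeg, hΨ, hfn]
    rfl
  · obtain ⟨a, rfl⟩ := L.freeAssembly.quotientPos_surjective _ x
    rw [hgp, ← assemblyMap_ePos, ← hΦ]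
    rfl
  · obtain ⟨a, rfl⟩ := L.freeAssembly.quotientNeg_surjective _ x
    rw [hgn, ← assemblyMap_eNeg, ← hΦ]
    rfl
  · obtain ⟨a, rfl⟩ := L.assemblyMapPos_surjective x
    show gp (fp _) = _
    rw [hfp, hgp]
    rfl
  · obtain ⟨a, rfl⟩ := L.assemblyMapNeg_surjective x
    show gn (fn _) = _
    rw [hfn, hgn]
    rfl
  · obtain ⟨a, rfl⟩ := L.freeAssembly.quotientPos_surjective _ x
    show fp (gp _) = _
    rw [hgp, hfp]
    rfl
  · obtain ⟨a, rfl⟩ := L.freeAssembly.quotientNeg_surjective _ x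
    show fn (gn _) = _
    rw [hgn, hfn]
    rfl

end Biframe

theorem mainTheorem8 (L : Biframe.{u}) :
    ∃! i : L.assembly ≅ L.freeAssembly.quotient L.assemblyRel,
      (∀ x : L.pos, i.hom.pos (L.nablaPos x) =
        L.freeAssembly.quotientPos L.assemblyRel (L.genPos x)) ∧
      (∀ x : L.neg, i.hom.pos (L.deltaNeg x) =
        L.freeAssembly.quotientPos L.assemblyRel (L.upNeg x)) ∧
      (∀ x : L.neg, i.hom.neg (L.nablaNeg x) =
        L.freeAssembly.quotientNeg L.assemblyRel (L.genNeg x)) ∧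
      (∀ x : L.pos, i.hom.neg (L.deltaPos x) =
        L.freeAssembly.quotientNeg L.assemblyRel (L.upPos x)) := by
  obtain ⟨i, hp, hn⟩ := L.exists_assemblyIso
  refine ⟨i, ⟨fun x => ?_, fun x => ?_, fun x => ?_, fun x => ?_⟩, ?_⟩
  · rw [← L.assemblyMapPos_genPos, hp]
  · rw [← L.assemblyMapPos_upNeg, hp]
  · rw [← L.assemblyMapNeg_genNeg, hn]
  · rw [← L.assemblyMapNeg_upPos, hn]
  · rintro k ⟨h1, h2, h3, h4⟩
    refine Iso.ext (Biframe.Hom.ext (FrameHom.ext ?_) (FrameHom.ext ?_))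
    · refine Subframe.mem_of_generators_mem (Subframe.equalizer k.hom.pos i.hom.pos) ?_
      rintro _ (⟨x, rfl⟩ | ⟨x, rfl⟩)
      · exact (h1 x).trans (by rw [← hp, L.assemblyMapPos_genPos]; rfl)
      · exact (h2 x).trans (by rw [← hp, L.assemblyMapPos_upNeg]; rfl)
    · refine Subframe.mem_of_generators_mem (Subframe.equalizer k.hom.neg i.hom.neg) ?_
      rintro _ (⟨x, rfl⟩ | ⟨x, rfl⟩)
      · exact (h3 x).trans (by rw [← hn, L.assemblyMapNeg_genNeg]; rfl)
      · exact (h4 x).trans (by rw [← hn, L.assemblyMapNeg_upPos]; rfl)
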